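/- **Setting.** Let $[x]$ be a nonzero entire function on $\mathbb{C}$ satisfying the Riemann relation $$[x\pm\alpha][\beta\pm\gamma]+[x\pm\beta][\gamma\pm\alpha]+[x\pm\gamma][\alpha\pm\beta]=0\qquad(x,\alpha,\beta,\gamma\in\mathbb{C}),$$ where $[x\pm y]=[x+y][x-y]$ (these are the rational, trigonometric and elliptic functions $[x]=e^{c_0x^2+c_1}x$, $e^{c_0x^2+c_1}\sin(\pi x/\omega)$, $e^{c_0x^2+c_1}\sigma(x|\Omega)$). For a constant $\delta\in\mathbb{C}$ put $[x]_k=[x][x+\delta]\cdots[x+(k-1)\delta]$, $[x\pm y]_k=[x+y]_k[x-y]_k$, and $$V^{(k)}[a_0;a_1,\dots,a_r]=\frac{[a_0+2k\delta]}{[a_0]}\frac{[a_0]_k[a_1]_k\cdots[a_r]_k}{[\delta]_k[\delta+a_0-a_1]_k\cdots[\delta+a_0-a_r]_k},\qquad {}_{r+5}V_{r+4}[a_0;a_1,\dots,a_r|z]=\sum_{k\ge0}V^{(k)}[a_0;a_1,\dots,a_r]\,z^k,$$ the latter for terminating series only. Let $m,n\ge0$, $N=m+n$, $a,b,c,d,u\in\mathbb{C}$,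 $u_k=u+k\delta$, $$f_j(x)=\frac{[a\pm x]_j}{[b\pm x]_j},\qquad g_j(x)=\frac{[c\pm x]_j}{[d\pm x]_j}.$$ Assume the parameters are generic: $[k\delta]\ne0$ for $1\le k\le N$, and $[2u+k\delta]$, $[u\pm p+k\delta]$ ($p\in\{a,b,c,d\}$), $[a\pm b+k\delta]$ (both signs), $[c\pm d+k\delta]$ (both signs) are nonzero for all integers $k$ with $|k|\le 2N$. Let $\lambda_k,\mu_k\in\mathbb{C}^\times$ ($0\le k\le N$), and let $$P_m(x)=\det\begin{bmatrix}f_0(x)&\cdots&f_m(x)&0&\cdots&0\\ \mu_if_0(u_i)&\cdots&\mu_if_m(u_i)&\lambda_ig_0(u_i)&\cdots&\lambda_ig_n(u_i)\end{bmatrix}_{i=0,\dots,N},$$ $$Q_n(x)=-\det\begin{bmatrix}0&\cdots&0&g_0(x)&\cdots&g_n(x)\\ \mu_if_0(u_i)&\cdots&\mu_if_m(u_i)&\lambda_ig_0(u_i)&\cdots&\lambda_ig_n(u_i)\end{bmatrix}_{i=0,\dots,N}$$ (one top row followed by $N+1$ rows). If $(P_m(u_k),Q_n(u_k))\ne(0,0)$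 for $0\le k\le N$, this pair is a solution of the Padé interpolation problem: $P_m$ is a linear combination of $f_0,\dots,f_m$, $Q_n$ is a linear combination of $g_0,\dots,g_n$, and $Q_n(u_k)\neq 0$, $P_m(u_k)/Q_n(u_k)=\lambda_k/\mu_k$ for $0\le k\le N$. **Matrices.** Put $$L_{ij}=V^{(j)}\big[2u;-N\delta,\,u-c+(1+i)\delta,\,u+d+(N-1-i)\delta,\,u+c,\,u-d+\delta\big]\quad(0\le i,j\le N),$$ $G=(g_j(u_i))_{0\le i\le N,\,0\le j\le n}$, $M=\big((LG)_{m+i,j}\big)_{i,j=0}^n$ and $K_{m,n}(c,d)=\det M/\det L$. Let $K_{n,m}(a,b)$ be obtained in the same way after exchanging $(m,n)$ with $(n,m)$ and $(c,d)$ with $(a,b)$. **Theorem.** For all $x$, $$P_m(x)=K_{m,n}(c,d)\prod_{i=0}^N\lambda_i\ \det\begin{bmatrix}f_0(x)&\cdots&f_m(x)\\ \Phi_{0,0}&\cdots&\Phi_{0,m}\\ \vdots&&\vdots\\ \Phi_{m-1,0}&\cdots&\Phi_{m-1,m}\end{bmatrix},$$ $$Q_n(x)=(-1)^{mn+m+n}K_{n,m}(a,b)\prod_{i=0}^N\mu_i\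 \det\begin{bmatrix}g_0(x)&\cdots&g_n(x)\\ \Psi_{0,0}&\cdots&\Psi_{0,n}\\ \vdots&&\vdots\\ \Psi_{n-1,0}&\cdots&\Psi_{n-1,n}\end{bmatrix},$$ where $$\Phi_{ij}=\frac{[a\pm u]_j}{[b\pm u]_j}\sum_{k=0}^NV^{(k)}\big[2u;-N\delta,u-c+\delta+i\delta,u+d+(N-1)\delta-i\delta,u+c,u-d+\delta,u+a+j\delta,u-b+\delta-j\delta,u-a+\delta,u+b\big]\frac{\mu_k}{\lambda_k},$$ $$\Psi_{ij}=\frac{[c\pm u]_j}{[d\pm u]_j}\sum_{k=0}^NV^{(k)}\big[2u;-N\delta,u-a+\delta+i\delta,u+b+(N-1)\delta-i\delta,u+a,u-b+\delta,u+c+j\delta,u-d+\delta-j\delta,u-c+\delta,u+d\big]\frac{\lambda_k}{\mu_k}.$$ Moreover, for $0\le i\le N$, $0\le j\le n$, $$(LG)_{ij}=\frac{[c+d+(j-i-1)\delta]_N[-(i+j)\delta]_N[2u+\delta]_N[d-c]_N}{[u+d+j\delta]_N[u-c+(1-j)\delta]_N[u+c-i\delta]_N[-u+d-(1+i)\delta]_N}\frac{[c\pm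 u]_j}{[d\pm u]_j},$$ so that $(LG)_{ij}=0$ for $i+j<N$; $$\det M=(-1)^{\binom{n+1}2}\prod_{j=0}^n\frac{[c\pm u]_j}{[d\pm u]_j}\prod_{j=0}^n\frac{[c+d-(N+1-2j)\delta]_N[-N\delta]_N[2u+\delta]_N[d-c]_N}{[u+d+j\delta]_N[u-c+(1-j)\delta]_N[u+c-(N-j)\delta]_N[-u+d-(N+1-j)\delta]_N};$$ and $\det L$ is nonzero and equals $$\frac{\prod_{j=1}^N[\delta]_j[c+d+(N-1-2j)\delta]_j[c-d-(N-1)\delta]_j[2u+j\delta]_j}{\prod_{i=0}^N[u+c-i\delta]_N[u-d-(N-2-i)\delta]_N}\prod_{j=0}^N\frac{[2u+2j\delta]}{[2u]}\frac{[2u]_j[-N\delta]_j[u+c]_j[u-d+\delta]_j}{[\delta]_j[2u+(N+1)\delta]_j[u-c+\delta]_j[u+d]_j};$$ and the same evaluations hold after exchanging $(m,n)$ with $(n,m)$ and $(c,d)$ with $(a,b)$. **Special values.** Let $r\ge0$ and $e_1,\dots,e_r,z,w\in\mathbb{C}$. (i) If $\dfrac{\lambda_k}{\mu_k}=\Big(\dfrac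 zw\Big)^k\displaystyle\prod_{s=1}^r\frac{[u-e_s+\delta]_k}{[u+e_s]_k}$ for $0\le k\le N$, then (for $0\le i<m$, $0\le j\le m$, respectively $0\le i<n$, $0\le j\le n$) $$\Phi_{ij}=\tfrac{[a\pm u]_j}{[b\pm u]_j}\,{}_{r+14}V_{r+13}\big[2u;-N\delta,u-c+\delta+i\delta,u+d+(N-1)\delta-i\delta,u+c,u-d+\delta,u+a+j\delta,u-b+\delta-j\delta,u-a+\delta,u+b,u+e_1,\dots,u+e_r\big|\tfrac wz\big],$$ $$\Psi_{ij}=\tfrac{[c\pm u]_j}{[d\pm u]_j}\,{}_{r+14}V_{r+13}\big[2u;-N\delta,u-a+\delta+i\delta,u+b+(N-1)\delta-i\delta,u+a,u-b+\delta,u+c+j\delta,u-d+\delta-j\delta,u-c+\delta,u+d,u-e_1+\delta,\dots,u-e_r+\delta\big|\tfrac zw\big].$$ (ii) If $\dfrac{\lambda_k}{\mu_k}=\Big(\dfrac zw\Big)^k\dfrac{[u-a+\delta]_k[u+b]_k}{[u+a]_k[u-b+\delta]_k}\dfrac{[u+c]_k[u-d+\delta]_k}{[u-c+\delta]_k[u+d]_k}\displaystyle\prod_{s=1}^r\frac{[u-e_s+\delta]_k}{[u+e_s]_k}$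 for $0\le k\le N$, then in the same ranges $$\Phi_{ij}=\tfrac{[a\pm u]_j}{[b\pm u]_j}\,{}_{r+10}V_{r+9}\big[2u;-N\delta,u-c+\delta+i\delta,u+d+(N-1)\delta-i\delta,u+a+j\delta,u-b+\delta-j\delta,u+e_1,\dots,u+e_r\big|\tfrac wz\big],$$ $$\Psi_{ij}=\tfrac{[c\pm u]_j}{[d\pm u]_j}\,{}_{r+10}V_{r+9}\big[2u;-N\delta,u-a+\delta+i\delta,u+b+(N-1)\delta-i\delta,u+c+j\delta,u-d+\delta-j\delta,u-e_1+\delta,\dots,u-e_r+\delta\big|\tfrac zw\big].$$ -/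

import Mathlib

noncomputable section

namespace VWPPade

open Finset

/-- The fundamental function `[x]`: a nonzero entire function satisfying the Riemann relation
`[x±α][β±γ] + [x±β][γ±α] + [x±γ][α±β] = 0`, where `[x±y] = [x+y][x-y]`
(the rational, trigonometric and elliptic functions `[x]`). -/
structure IsFundamental (θ : ℂ → ℂ) : Prop where
  entire : Differentiable ℂ θ
  ne_zero : θ ≠ 0
  riemann : ∀ x α β γ : ℂ,
    θ (x + α) * θ (x - α) * (θ (β + γ) * θ (β - γ))
      + θ (x + β) * θ (x - β) * (θ (γ + α) * θ (γ - α))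
      + θ (x + γ) * θ (x - γ) * (θ (α + β) * θ (α - β)) = 0

/-- The `δ`-shifted factorial `[x]_k = [x][x+δ]⋯[x+(k-1)δ]`. -/
def sfac (θ : ℂ → ℂ) (δ x : ℂ) (k : ℕ) : ℂ :=
  ∏ l ∈ range k, θ (x + l * δ)

/-- The product `[x±y]_k = [x+y]_k [x-y]_k`. -/
def sfacPM (θ : ℂ → ℂ) (δ x y : ℂ) (k : ℕ) : ℂ :=
  sfac θ δ (x + y) k * sfac θ δ (x - y) k

/-- The `k`-th term `V^{(k)}[a₀; a₁, …, a_r]` of a very well-poised series. -/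
def vterm (θ : ℂ → ℂ) (δ a₀ : ℂ) (as : List ℂ) (k : ℕ) : ℂ :=
  θ (a₀ + 2 * k * δ) / θ a₀ * (sfac θ δ a₀ k / sfac θ δ δ k)
    * (as.map fun a => sfac θ δ a k / sfac θ δ (δ + a₀ - a) k).prod

/-- The very well-poised series `_{r+5}V_{r+4}[a₀; a₁, …, a_r | z]`, where `r` is the length of
the list. It is only used in the terminating case, when some `a_i` is `-nδ` with `n ∈ ℕ`; then
all terms with `k > n` vanish because `[0] = 0`. -/
def vseries (θ : ℂ → ℂ) (δ a₀ : ℂ) (as : List ℂ) (z : ℂ) : ℂ :=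
  ∑' k : ℕ, vterm θ δ a₀ as k * z ^ k

/-- The functions `x ↦ [a±x]_j / [b±x]_j`. -/
def basisFun (θ : ℂ → ℂ) (δ a b : ℂ) (j : ℕ) (x : ℂ) : ℂ :=
  sfacPM θ δ a x j / sfacPM θ δ b x j

/-- The reference points `u_k = u + kδ`. -/
def refPt (δ u : ℂ) (k : ℕ) : ℂ := u + k * δ

/-! ### The Padé interpolation problem and its general determinant solution -/

/-- `(P, Q)` solves the Padé interpolation problem: `P` is a linear combination of
`f_0, …, f_m`, `Q` is a linear combination of `g_0, …, g_n`, and `P(u_k)/Q(u_k) = λ_k/μ_k`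
for `k = 0, …, m+n`. -/
def IsPadeSolution (m n : ℕ) (f g : ℕ → ℂ → ℂ) (pt lam mu : ℕ → ℂ) (P Q : ℂ → ℂ) : Prop :=
  (∃ p : Fin (m + 1) → ℂ, ∀ x, P x = ∑ j, p j * f j x) ∧
  (∃ q : Fin (n + 1) → ℂ, ∀ x, Q x = ∑ j, q j * g j x) ∧
  ∀ k ≤ m + n, Q (pt k) ≠ 0 ∧ P (pt k) / Q (pt k) = lam k / mu k

/-- The `(m+n+2) × (m+n+2)` matrix whose top row is `(s, t)` and whose following rows are
`(μ_i f_0(u_i), …, μ_i f_m(u_i), λ_i g_0(u_i), …, λ_i g_n(u_i))`, `i = 0, …, m+n`. -/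
def padeMatrix (m n : ℕ) (f g : ℕ → ℂ → ℂ) (pt lam mu : ℕ → ℂ)
    (s : Fin (m + 1) → ℂ) (t : Fin (n + 1) → ℂ) :
    Matrix (Fin (m + 1 + n + 1)) (Fin (m + 1 + n + 1)) ℂ :=
  Matrix.of (Fin.cons (Fin.append (m := m + 1) (n := n + 1) s t) fun i : Fin (m + 1 + n) =>
    Fin.append (m := m + 1) (n := n + 1) (fun j => mu i * f j (pt i)) fun j => lam i * g j (pt i))

/-- The function `P_m` of the general solution. -/
def padeP (m n : ℕ) (f g : ℕ → ℂ → ℂ) (pt lam mu : ℕ → ℂ) (x : ℂ) : ℂ :=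
  (padeMatrix m n f g pt lam mu (fun j => f j x) (fun _ => 0)).det

/-- The function `Q_n` of the general solution. -/
def padeQ (m n : ℕ) (f g : ℕ → ℂ → ℂ) (pt lam mu : ℕ → ℂ) (x : ℂ) : ℂ :=
  -(padeMatrix m n f g pt lam mu (fun _ => 0) (fun j => g j x)).det

/-- The `(m+1) × (m+1)` matrix with top row `f_0(x), …, f_m(x)` and following rows
`Φ_{i,0}, …, Φ_{i,m}`, `i = 0, …, m-1`. -/
def topRowMatrix (m : ℕ) (f : ℕ → ℂ → ℂ) (Φ : ℕ → ℕ → ℂ) (x : ℂ) :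
    Matrix (Fin (m + 1)) (Fin (m + 1)) ℂ :=
  Matrix.of (Fin.cons (fun j : Fin (m + 1) => f j x) fun (i : Fin m) (j : Fin (m + 1)) => Φ i j)

/-! ### The matrices `L`, `G`, `M` and the constant `K` -/

/-- The matrix `L = (L_{ij})_{i,j=0}^N`. -/
def matL (θ : ℂ → ℂ) (δ u : ℂ) (N : ℕ) (c d : ℂ) : Matrix (Fin (N + 1)) (Fin (N + 1)) ℂ :=
  Matrix.of fun i j => vterm θ δ (2 * u)
    [-(N * δ), u - c + (1 + (i : ℕ)) * δ, u + d + (N - 1 - (i : ℕ)) * δ, u + c, u - d + δ] j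

/-- The matrix `G = (g_j(u_i))`, `0 ≤ i ≤ N`, `0 ≤ j ≤ n`, with `g_j(x) = [c±x]_j/[d±x]_j`. -/
def matG (θ : ℂ → ℂ) (δ u : ℂ) (N n : ℕ) (c d : ℂ) : Matrix (Fin (N + 1)) (Fin (n + 1)) ℂ :=
  Matrix.of fun i j => basisFun θ δ c d j (refPt δ u i)

/-- The matrix `M = (M_{ij})_{i,j=0}^n`, `M_{ij} = (LG)_{m+i,j}`, where `N = m + n`. -/
def matM (θ : ℂ → ℂ) (δ u : ℂ) (m n : ℕ) (c d : ℂ) : Matrix (Fin (n + 1)) (Fin (n + 1)) ℂ :=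
  Matrix.of fun i j => (matL θ δ u (m + n) c d * matG θ δ u (m + n) n c d) (Fin.natAdd m i) j

/-- The constant `K_{m,n}(c,d) = det M / det L`. -/
def constK (θ : ℂ → ℂ) (δ u : ℂ) (m n : ℕ) (c d : ℂ) : ℂ :=
  (matM θ δ u m n c d).det / (matL θ δ u (m + n) c d).det

/-- The factorized expression for `(LG)_{ij}`. -/
def valueLG (θ : ℂ → ℂ) (δ u : ℂ) (N : ℕ) (c d : ℂ) (i j : ℕ) : ℂ :=
  sfac θ δ (c + d + (j - i - 1) * δ) N * sfac θ δ (-((i + j) * δ)) N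
      * sfac θ δ (2 * u + δ) N * sfac θ δ (d - c) N
    / (sfac θ δ (u + d + j * δ) N * sfac θ δ (u - c + (1 - j) * δ) N
      * sfac θ δ (u + c - i * δ) N * sfac θ δ (-u + d - (1 + i) * δ) N)
    * (sfacPM θ δ c u j / sfacPM θ δ d u j)

/-- The factorized expression for `det M`, where `N = m + n`. -/
def valueDetM (θ : ℂ → ℂ) (δ u : ℂ) (N n : ℕ) (c d : ℂ) : ℂ :=
  (-1) ^ (n + 1).choose 2
    * (∏ j ∈ range (n + 1), sfacPM θ δ c u j / sfacPM θ δ d u j)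
    * ∏ j ∈ range (n + 1),
        sfac θ δ (c + d - (N + 1 - 2 * j) * δ) N * sfac θ δ (-(N * δ)) N
            * sfac θ δ (2 * u + δ) N * sfac θ δ (d - c) N
          / (sfac θ δ (u + d + j * δ) N * sfac θ δ (u - c + (1 - j) * δ) N
            * sfac θ δ (u + c - (N - j) * δ) N * sfac θ δ (-u + d - (N + 1 - j) * δ) N)

/-- The factorized expression for `det L`. -/
def valueDetL (θ : ℂ → ℂ) (δ u : ℂ) (N : ℕ) (c d : ℂ) : ℂ :=
  (∏ j ∈ Icc 1 N, sfac θ δ δ j * sfac θ δ (c + d + (N - 1 - 2 * j) * δ) j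
      * sfac θ δ (c - d - (N - 1) * δ) j * sfac θ δ (2 * u + j * δ) j)
    / (∏ i ∈ range (N + 1),
        sfac θ δ (u + c - i * δ) N * sfac θ δ (u - d - (N - 2 - i) * δ) N)
    * ∏ j ∈ range (N + 1), θ (2 * u + 2 * j * δ) / θ (2 * u)
        * (sfac θ δ (2 * u) j * sfac θ δ (-(N * δ)) j
            * sfac θ δ (u + c) j * sfac θ δ (u - d + δ) j
          / (sfac θ δ δ j * sfac θ δ (2 * u + (N + 1) * δ) j
            * sfac θ δ (u - c + δ) j * sfac θ δ (u + d) j))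

/-! ### The entries of the determinants -/

/-- The entry `Φ_{ij}` for the pair of functions `f_j(x) = [a±x]_j/[b±x]_j`,
`g_j(x) = [c±x]_j/[d±x]_j` and the ratios `ρ_k = μ_k/λ_k`. Exchanging the roles of `(a,b)` and
`(c,d)` and taking `ρ_k = λ_k/μ_k` gives `Ψ_{ij}`. -/
def entryΦ (θ : ℂ → ℂ) (δ u : ℂ) (N : ℕ) (a b c d : ℂ) (ρ : ℕ → ℂ) (i j : ℕ) : ℂ :=
  sfacPM θ δ a u j / sfacPM θ δ b u j * ∑ k ∈ range (N + 1),
    vterm θ δ (2 * u)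
      [-(N * δ), u - c + δ + i * δ, u + d + (N - 1) * δ - i * δ, u + c, u - d + δ,
        u + a + j * δ, u - b + δ - j * δ, u - a + δ, u + b] k * ρ k

/-! ### Genericity -/

/-- The parameters are generic up to order `N`: none of the factors `[kδ]` with `1 ≤ k ≤ N`,
and none of `[2u+kδ]`, `[u±p+kδ]` with `p ∈ {a,b,c,d}`, `[a±b+kδ]`, `[c±d+kδ]` with
`-2N ≤ k ≤ 2N`, vanishes. -/
structure IsGeneric (θ : ℂ → ℂ) (δ u : ℂ) (N : ℕ) (a b c d : ℂ) : Prop where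
  step : ∀ k : ℕ, 1 ≤ k → k ≤ N → θ (k * δ) ≠ 0
  base : ∀ k : ℤ, |k| ≤ 2 * N → θ (2 * u + k * δ) ≠ 0
  param : ∀ p ∈ [a, b, c, d], ∀ k : ℤ, |k| ≤ 2 * N →
    θ (u + p + k * δ) ≠ 0 ∧ θ (u - p + k * δ) ≠ 0
  pair_ab : ∀ k : ℤ, |k| ≤ 2 * N → θ (a + b + k * δ) ≠ 0 ∧ θ (a - b + k * δ) ≠ 0
  pair_cd : ∀ k : ℤ, |k| ≤ 2 * N → θ (c + d + k * δ) ≠ 0 ∧ θ (c - d + k * δ) ≠ 0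

end VWPPade

end

open VWPPade

noncomputable section

namespace VWPPade

open Finset

/-! ### The fundamental function -/

namespace IsFundamental

variable {θ : ℂ → ℂ}

/-! In the matrix defining `P_m`, divide the interpolation row at `u_k` by `λ_k`, so that its right
block becomes `G`, and multiply these rows by `L`. If the first `m` rows of `L` annihilate every
column of `G`, the result is block lower triangular: one diagonal block has top row `f_0(x), …,
f_m(x)` and below it the sums of `L_{ik} f_j(u_k) μ_k/λ_k` over `k`, the other is `M`. Comparing
determinants gives `P_m` with the constant `det M / det L` (`det_mul_det_padeMatrix`). Interchanging
the two column blocks exchanges `(f, μ)` with `(g, λ)` and yields `Q_n` (`det_padeMatrix_swap`).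

The matrix `L` is designed for this annihilation. Up to a factor free of `k`, the value `g_j(u_k)`
is a product of well-poised quotients relative to `2u`; two of them cancel factors of `L_{ik}`, and
what remains is the `k`-th term of a balanced terminating `₁₀V₉` (`entryL_mul_basisFun`). The
Frenkel–Turaev sum (`sum_ftTerm`) then evaluates `LG` in closed form, with a factor `[-(i+j)δ]_N`
that vanishes for `i + j < N`. The same vanishing makes `M` triangular with respect to its
antidiagonal, so `det M` is a product. With `f_j` in place of `g_j` all the factors stay, which
produces the longer series `Φ`.

Dividing by `det L` is legitimate because, after scaling rows and columns, it is the determinant of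
`[p±X_i]_j [q+jδ±X_i]_{N-j}`, a product by elimination (`det_ipMatrix`). Both this elimination and
the Frenkel–Turaev sum are inductions on `N` in which each step is one instance of the Riemann
relation. -/

theorem map_zero (hθ : IsFundamental θ) : θ 0 = 0 := by
  have h := hθ.riemann 0 0 0 0
  simp only [add_zero, sub_zero] at h
  have h' : 3 * θ 0 ^ 4 = 0 := by linear_combination h
  simpa using h'

/-- The product of two translates of `θ` does not vanish identically. -/
theorem exists_mul_ne_zero (hθ : IsFundamental θ) (p q : ℂ) :
    ∃ x, θ (x + p) * θ (x + q) ≠ 0 := by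
  by_contra! h
  have hd : ∀ p : ℂ, AnalyticOnNhd ℂ (fun x => θ (x + p)) Set.univ := fun p =>
    (hθ.entire.comp (differentiable_id.add_const p)).differentiableOn.analyticOnNhd isOpen_univ
  have hz : ∀ p : ℂ, (∀ x ∈ (Set.univ : Set ℂ), θ (x + p) = 0) → False := fun p h0 =>
    hθ.ne_zero (funext fun x => by simpa using h0 (x - p) (Set.mem_univ _))
  rcases (hd p).eq_zero_or_eq_zero_of_mul_eq_zero (hd q) (fun x _ => h x)
    isPreconnected_univ with h0 | h0
  · exact hz p h0
  · exact hz q h0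

theorem map_neg (hθ : IsFundamental θ) (y : ℂ) : θ (-y) = -θ y := by
  obtain ⟨s, hs⟩ := hθ.exists_mul_ne_zero 0 0
  obtain ⟨x, hx⟩ := hθ.exists_mul_ne_zero ((s + y) / 2) (-((s + y) / 2))
  -- With `β = γ` the first product contains `[0] = 0`, and the other two share the factor
  -- `[x±β][s]`, leaving `[-y] + [y]`. The points `s` and `x` were chosen so that this factor is
  -- nonzero.
  have h := hθ.riemann x ((s - y) / 2) ((s + y) / 2) ((s + y) / 2)
  have e1 : (s + y) / 2 + (s - y) / 2 = s := by ring
  have e2 : (s + y) / 2 - (s - y) / 2 = y := by ring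
  have e3 : (s - y) / 2 + (s + y) / 2 = s := by ring
  have e4 : (s - y) / 2 - (s + y) / 2 = -y := by ring
  rw [sub_self, hθ.map_zero, e1, e2, e3, e4] at h
  rw [← sub_eq_add_neg] at hx
  rw [add_zero] at hs
  have h' : (θ (x + (s + y) / 2) * θ (x - (s + y) / 2)) * (θ s * (θ (-y) + θ y)) = 0 := by
    linear_combination h
  have h2 := (mul_eq_zero.mp h').resolve_left hx
  exact eq_neg_of_add_eq_zero_left ((mul_eq_zero.mp h2).resolve_left (left_ne_zero_of_mul hs))

/-- The Riemann relation, solved for a difference of two products. -/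
theorem riemann_sub (hθ : IsFundamental θ) (x y z w : ℂ) :
    θ (x + y) * θ (x - y) * (θ (z + w) * θ (z - w))
        - θ (x + w) * θ (x - w) * (θ (z + y) * θ (z - y))
      = θ (x + z) * θ (x - z) * (θ (y + w) * θ (w - y)) * (-1) := by
  have h := hθ.riemann x y z w
  have e := hθ.map_neg (z - y)
  have e' := hθ.map_neg (w - y)
  rw [neg_sub] at e e'
  rw [add_comm w y, add_comm y z, e] at h
  linear_combination h

end IsFundamental

/-! ### Shifted factorials -/

section ShiftedFactorial

variable {θ : ℂ → ℂ} {δ : ℂ}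

@[simp]
theorem sfac_zero (x : ℂ) : sfac θ δ x 0 = 1 := by simp [sfac]

theorem sfac_succ (x : ℂ) (k : ℕ) : sfac θ δ x (k + 1) = sfac θ δ x k * θ (x + k * δ) := by
  rw [sfac, prod_range_succ, sfac]

theorem sfac_add (x : ℂ) (j k : ℕ) :
    sfac θ δ x (j + k) = sfac θ δ x j * sfac θ δ (x + j * δ) k := by
  rw [sfac, prod_range_add, sfac, sfac]
  congr 1
  refine prod_congr rfl fun l _ => ?_
  congr 1
  push_cast
  ring

theorem sfac_succ_left (x : ℂ) (k : ℕ) :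
    sfac θ δ x (k + 1) = θ x * sfac θ δ (x + δ) k := by
  rw [add_comm, sfac_add]
  simp [sfac]

theorem sfac_ne_zero {x : ℂ} {k : ℕ} (h : ∀ l < k, θ (x + l * δ) ≠ 0) : sfac θ δ x k ≠ 0 :=
  prod_ne_zero_iff.mpr fun l hl => h l (mem_range.mp hl)

/-- Oddness of `θ` turns the factors of one product, read backwards, into those of the other. -/
theorem sfac_reflect (hθ : IsFundamental θ) {x y : ℂ} {k : ℕ} (h : x + y + k * δ = δ) :
    sfac θ δ x k = (-1) ^ k * sfac θ δ y k := by
  rw [sfac, sfac, ← prod_range_reflect, ← card_range k, ← prod_const, card_range,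
    ← prod_mul_distrib]
  refine prod_congr rfl fun l hl => ?_
  have hl' := mem_range.mp hl
  have e : ((k - 1 - l : ℕ) : ℂ) = k - 1 - l := by
    rw [Nat.cast_sub (by omega), Nat.cast_sub (by omega), Nat.cast_one]
  rw [neg_one_mul, ← hθ.map_neg, e]
  congr 1
  linear_combination h

theorem sfac_neg_eq_zero (hθ : IsFundamental θ) {j k : ℕ} (h : j < k) :
    sfac θ δ (-(j * δ)) k = 0 :=
  prod_eq_zero (mem_range.mpr h) (by rw [neg_add_cancel, hθ.map_zero])

end ShiftedFactorial

/-! ### The Frenkel–Turaev summation -/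

section FrenkelTuraev

variable {θ : ℂ → ℂ} {δ : ℂ}

/-- The `k`-th term of the balanced terminating series `₁₀V₉[a; b, c, d, e, -Nδ]`,
where `e = 2a + (N+1)δ - b - c - d`. -/
def ftTerm (θ : ℂ → ℂ) (δ : ℂ) (N : ℕ) (a b c d : ℂ) (k : ℕ) : ℂ :=
  θ (a + 2 * k * δ) / θ a * (sfac θ δ a k / sfac θ δ δ k)
    * (sfac θ δ b k / sfac θ δ (a + δ - b) k)
    * (sfac θ δ c k / sfac θ δ (a + δ - c) k)
    * (sfac θ δ d k / sfac θ δ (a + δ - d) k)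
    * (sfac θ δ (2 * a + (N + 1) * δ - b - c - d) k / sfac θ δ (b + c + d - a - N * δ) k)
    * (sfac θ δ (-(N * δ)) k / sfac θ δ (a + (N + 1) * δ) k)

/-- The value of the Frenkel–Turaev sum. -/
def ftValue (θ : ℂ → ℂ) (δ : ℂ) (N : ℕ) (a b c d : ℂ) : ℂ :=
  sfac θ δ (a + δ) N * sfac θ δ (a + δ - b - c) N * sfac θ δ (a + δ - b - d) N
      * sfac θ δ (a + δ - c - d) N
    / (sfac θ δ (a + δ - b) N * sfac θ δ (a + δ - c) N * sfac θ δ (a + δ - d) N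
      * sfac θ δ (a + δ - b - c - d) N)

/-- Sufficient conditions for the inductive proof of the Frenkel–Turaev summation. -/
structure FTGeneric (θ : ℂ → ℂ) (δ : ℂ) (N : ℕ) (a b c d : ℂ) : Prop where
  step : ∀ k : ℕ, k < N → θ (δ + k * δ) ≠ 0
  base : ∀ k : ℕ, k ≤ 2 * N → θ (a + k * δ) ≠ 0
  fst : ∀ k : ℕ, k < N → θ (a + δ - b + k * δ) ≠ 0
  snd : ∀ k : ℕ, k < N → θ (a + δ - c + k * δ) ≠ 0
  trd : ∀ k : ℕ, k < N → θ (a + δ - d + k * δ) ≠ 0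
  bal : ∀ k : ℕ, k < 2 * N → θ (b + c + d - a - N * δ + k * δ) ≠ 0

theorem FTGeneric.pred {N : ℕ} {a b c d : ℂ} (h : FTGeneric θ δ (N + 1) a b c d) :
    FTGeneric θ δ N a b c d where
  step k hk := h.step k (by omega)
  base k hk := h.base k (by omega)
  fst k hk := h.fst k (by omega)
  snd k hk := h.snd k (by omega)
  trd k hk := h.trd k (by omega)
  bal k hk := by
    have := h.bal (k + 1) (by omega)
    convert this using 2
    push_cast
    ring

/-- In `base` and `bal` the shifted parameters move the index by two while `N` drops by one; the
ranges up to `2 * N` are what make the conditions inductive. -/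
theorem FTGeneric.shift {N : ℕ} {a b c d : ℂ} (h : FTGeneric θ δ (N + 1) a b c d) :
    FTGeneric θ δ N (a + 2 * δ) (b + δ) (c + δ) (d + δ) where
  step k hk := h.step k (by omega)
  base k hk := by
    convert h.base (k + 2) (by omega) using 2
    push_cast
    ring
  fst k hk := by
    convert h.fst (k + 1) (by omega) using 2
    push_cast
    ring
  snd k hk := by
    convert h.snd (k + 1) (by omega) using 2
    push_cast
    ring
  trd k hk := by
    convert h.trd (k + 1) (by omega) using 2
    push_cast
    ring
  bal k hk := by
    convert h.bal (k + 2) (by omega) using 2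
    push_cast
    ring

/-- The coefficient in the recurrence of `ftTerm` in `N`. -/
def ftCoeff (θ : ℂ → ℂ) (δ : ℂ) (N : ℕ) (a b c d : ℂ) : ℂ :=
  -(θ (a + δ) * θ (a + 2 * δ) * (θ b / θ (a + δ - b)) * (θ c / θ (a + δ - c))
      * (θ d / θ (a + δ - d))
      * (θ (2 * a + (2 * N + 2) * δ - b - c - d) * θ (b + c + d - a)))
    / (θ (b + c + d - a - (N + 1) * δ) * θ (b + c + d - a - N * δ)
      * θ (a + (N + 1) * δ) * θ (a + (N + 2) * δ))

theorem ftTerm_zero {N : ℕ} {a b c d : ℂ} (ha : θ a ≠ 0) : ftTerm θ δ N a b c d 0 = 1 := by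
  simp [ftTerm, ha]

theorem ftTerm_eq_zero (hθ : IsFundamental θ) {N k : ℕ} (h : N < k) (a b c d : ℂ) :
    ftTerm θ δ N a b c d k = 0 := by
  rw [ftTerm, sfac_neg_eq_zero hθ h, zero_div, mul_zero]

/-- The field identity behind `ftTerm_succ`, with theta values as independent atoms. Only the
parameters depending on `N` change between the two terms on the left and right, so the `b`, `c`, `d`
quotients are mere common factors; `hR` is the Riemann relation and `hA`, `hG`, `hF` split a shifted
factorial at either end. -/
theorem ftTerm_succ_aux {K a0 a1 a2 ak A1 A2 S s b0 B c0 C d0 D e0 E ek g0 g1 gk G1 G2 n1 M nk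
      f0 f1 fk F1 F2 X Y : ℂ}
    (ha0 : a0 ≠ 0) (ha1 : a1 ≠ 0) (ha2 : a2 ≠ 0) (hS : S ≠ 0) (hs : s ≠ 0)
    (hg0 : g0 ≠ 0) (hg1 : g1 ≠ 0) (hgk : gk ≠ 0) (hG1 : G1 ≠ 0)
    (hf0 : f0 ≠ 0) (hf1 : f1 ≠ 0) (hfk : fk ≠ 0) (hF1 : F1 ≠ 0)
    (hA : A1 * ak = a1 * A2) (hG : G1 * gk = g1 * G2) (hF : F1 * fk = f1 * F2)
    (hR : ek * gk * (f0 * n1) - fk * nk * (e0 * g0) = ak * s * (X * Y) * (-1)) :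
    K / a0 * (a0 * A1 / (S * s)) * (b0 * B) * (c0 * C) * (d0 * D)
        * (E * ek / (g0 * G1)) * (n1 * M / (F1 * fk))
      = K / a0 * (a0 * A1 / (S * s)) * (b0 * B) * (c0 * C) * (d0 * D)
        * (e0 * E / (G1 * gk)) * (M * nk / (f0 * F1))
      + -(a1 * a2 * b0 * c0 * d0 * (X * Y)) / (g0 * g1 * f0 * f1)
        * (K / a2 * (A2 / S) * B * C * D * (E / G2) * (M / F2)) := by
  obtain rfl : A2 = A1 * ak / a1 := by field_simp; linear_combination -hA
  obtain rfl : G2 = G1 * gk / g1 := by field_simp; linear_combination -hG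
  obtain rfl : F2 = F1 * fk / f1 := by field_simp; linear_combination -hF
  have hq : ek * n1 / (g0 * fk)
      = e0 * nk / (gk * f0) - ak * (X * Y) * s / (g0 * f0 * gk * fk) := by
    field_simp
    linear_combination hR
  have h1 : K / a0 * (a0 * A1 / (S * s)) * (E * ek / (g0 * G1)) * (n1 * M / (F1 * fk))
      = K * A1 * E * M / (S * s * G1 * F1) * (ek * n1 / (g0 * fk)) := by field_simp
  have h2 : K / a0 * (a0 * A1 / (S * s)) * (e0 * E / (G1 * gk)) * (M * nk / (f0 * F1))
      = K * A1 * E * M / (S * s * G1 * F1) * (e0 * nk / (gk * f0)) := by field_simp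
  have h3 : a1 * a2 * (X * Y) / (g0 * g1 * f0 * f1) * (K / a2 * (A1 * ak / a1 / S)
        * (E / (G1 * gk / g1)) * (M / (F1 * fk / f1)))
      = K * A1 * E * M / (S * s * G1 * F1) * (ak * (X * Y) * s / (g0 * f0 * gk * fk)) := by
    field_simp
  rw [hq] at h1
  linear_combination (b0 * B * c0 * C * d0 * D) * (h1 - h2 + h3)

/-- The analogue for the closed form: by `hR`, the ratio of consecutive values minus one is a single
quotient, which is then matched with the shifted value. -/
theorem ftValue_succ_aux {p0 p1 a1 a2 P P' Q1 Q2 Q3 q1 q2 q3 b1 c1 d1 bN cN dN B' C' D' B C D G G'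
      b0 c0 d0 X Y g0 g1 e0 e1 : ℂ}
    (hp0 : p0 ≠ 0) (hp1 : p1 ≠ 0) (ha1 : a1 ≠ 0) (ha2 : a2 ≠ 0)
    (hb1 : b1 ≠ 0) (hc1 : c1 ≠ 0) (hd1 : d1 ≠ 0) (hbN : bN ≠ 0) (hcN : cN ≠ 0) (hdN : dN ≠ 0)
    (hB : B ≠ 0) (hC : C ≠ 0) (hD : D ≠ 0) (hG : G ≠ 0) (hG' : G' ≠ 0)
    (hg0 : g0 ≠ 0) (hg1 : g1 ≠ 0) (hY : Y ≠ 0)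
    (hP : P * p0 * p1 = a1 * a2 * P') (hBB : B * bN = b1 * B') (hCC : C * cN = c1 * C')
    (hDD : D * dN = d1 * D') (hGG : G' * e1 = e0 * G) (he0 : e0 = -Y) (he1 : e1 = -g1)
    (hR : p0 * q1 * (q2 * q3) - bN * cN * (dN * -g0) = X * d0 * (c0 * -b0) * (-1)) :
    P * p0 * (Q1 * q1) * (Q2 * q2) * (Q3 * q3) / (B * bN * (C * cN) * (D * dN) * (G * -g0))
      = P * Q1 * Q2 * Q3 / (B * C * D * G)
      + -(a1 * a2 * (b0 / b1) * (c0 / c1) * (d0 / d1) * (X * Y)) / (g0 * g1 * p0 * p1)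
        * (P' * Q1 * Q2 * Q3 / (B' * C' * D' * G')) := by
  obtain rfl : P' = P * p0 * p1 / (a1 * a2) := by field_simp; linear_combination -hP
  obtain rfl : B' = B * bN / b1 := by field_simp; linear_combination -hBB
  obtain rfl : C' = C * cN / c1 := by field_simp; linear_combination -hCC
  obtain rfl : D' = D * dN / d1 := by field_simp; linear_combination -hDD
  have hGY : G * Y = G' * g1 := by subst he0 he1; linear_combination hGG
  obtain rfl : G' = G * Y / g1 := by field_simp; linear_combination -hGY
  have hq : p0 * q1 * q2 * q3 / (bN * cN * dN * -g0)
      = 1 + -(b0 * c0 * d0 * X) / (bN * cN * dN * g0) := by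
    field_simp
    linear_combination -hR
  have h1 : P * p0 * (Q1 * q1) * (Q2 * q2) * (Q3 * q3) / (B * bN * (C * cN) * (D * dN) * (G * -g0))
      = P * Q1 * Q2 * Q3 / (B * C * D * G) * (p0 * q1 * q2 * q3 / (bN * cN * dN * -g0)) := by
    field_simp
  rw [h1, hq, mul_add, mul_one]
  congr 1
  field_simp

theorem ftTerm_succ (hθ : IsFundamental θ) {N k : ℕ} (hk : k ≤ N) {a b c d : ℂ}
    (h : FTGeneric θ δ (N + 1) a b c d) :
    ftTerm θ δ (N + 1) a b c d (k + 1) = ftTerm θ δ N a b c d (k + 1)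
      + ftCoeff θ δ N a b c d * ftTerm θ δ N (a + 2 * δ) (b + δ) (c + δ) (d + δ) k := by
  -- These half-sums and half-differences make the arguments exactly those of the end factors that
  -- change with `N`; the right-hand side supplies the `k`-dependent factors `[a+(k+1)δ][(k+1)δ]`.
  have hR := hθ.riemann_sub (a / 2 + (k + 1) * δ) (3 / 2 * a + (N + 1) * δ - b - c - d) (a / 2)
    (a / 2 + (N + 1) * δ)
  have hA := sfac_succ_left (θ := θ) (δ := δ) (a + δ) k
  have hG := sfac_succ_left (θ := θ) (δ := δ) (b + c + d - a - N * δ) k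
  have hF := sfac_succ_left (θ := θ) (δ := δ) (a + (N + 2) * δ) k
  rw [sfac_succ] at hA hG hF
  have key := ftTerm_succ_aux (K := θ (a + 2 * (k + 1) * δ)) (a0 := θ a) (a2 := θ (a + 2 * δ))
    (S := sfac θ δ δ k) (s := θ (δ + k * δ))
    (b0 := θ b / θ (a + δ - b)) (B := sfac θ δ (b + δ) k / sfac θ δ (a + δ - b + δ) k)
    (c0 := θ c / θ (a + δ - c)) (C := sfac θ δ (c + δ) k / sfac θ δ (a + δ - c + δ) k)
    (d0 := θ d / θ (a + δ - d)) (D := sfac θ δ (d + δ) k / sfac θ δ (a + δ - d + δ) k)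
    (e0 := θ (2 * a + (N + 1) * δ - b - c - d))
    (ek := θ (2 * a + (N + 2) * δ - b - c - d + k * δ))
    (E := sfac θ δ (2 * a + (N + 2) * δ - b - c - d) k)
    (g0 := θ (b + c + d - a - (N + 1) * δ))
    (n1 := θ (-((N + 1) * δ))) (nk := θ (-(N * δ) + k * δ)) (M := sfac θ δ (-(N * δ)) k)
    (f0 := θ (a + (N + 1) * δ))
    (X := θ (2 * a + (2 * N + 2) * δ - b - c - d)) (Y := θ (b + c + d - a))
    (by simpa using h.base 0 (by omega)) (by simpa using h.base 1 (by omega))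
    (by simpa using h.base 2 (by omega)) (sfac_ne_zero fun l hl => h.step l (by omega))
    (h.step k (by omega)) (by simpa using h.bal 0 (by omega))
    (by convert h.bal 1 (by omega) using 2; push_cast; ring)
    (by convert h.bal (k + 1) (by omega) using 2; push_cast; ring)
    (sfac_ne_zero fun l hl => by
      convert h.bal (l + 1) (by omega) using 2; push_cast; ring)
    (by convert h.base (N + 1) (by omega) using 2; push_cast; ring)
    (by convert h.base (N + 2) (by omega) using 2; push_cast; ring)
    (by convert h.base (N + 2 + k) (by omega) using 2; push_cast; ring)
    (sfac_ne_zero fun l hl => by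
      convert h.base (N + 2 + l) (by omega) using 2; push_cast; ring)
    hA hG hF (by convert hR using 4 <;> ring_nf)
  have e1 : sfac θ δ (2 * a + ((N + 1 : ℕ) + 1) * δ - b - c - d) (k + 1)
      = sfac θ δ (2 * a + (N + 2) * δ - b - c - d) k
        * θ (2 * a + (N + 2) * δ - b - c - d + k * δ) := by
    rw [← sfac_succ]; congr 1; push_cast; ring
  have e2 : sfac θ δ (b + c + d - a - (N + 1 : ℕ) * δ) (k + 1)
      = θ (b + c + d - a - (N + 1) * δ) * sfac θ δ (b + c + d - a - N * δ) k := by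
    rw [sfac_succ_left]; congr 2 <;> push_cast <;> ring
  have e3 : sfac θ δ (-((N + 1 : ℕ) * δ)) (k + 1)
      = θ (-((N + 1) * δ)) * sfac θ δ (-(N * δ)) k := by
    rw [sfac_succ_left]; congr 2 <;> push_cast <;> ring
  have e4 : sfac θ δ (a + ((N + 1 : ℕ) + 1) * δ) (k + 1)
      = sfac θ δ (a + (N + 2) * δ) k * θ (a + (N + 2) * δ + k * δ) := by
    rw [← sfac_succ]; congr 1; push_cast; ring
  have e5 : sfac θ δ (2 * a + (N + 1) * δ - b - c - d) (k + 1)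
      = θ (2 * a + (N + 1) * δ - b - c - d) * sfac θ δ (2 * a + (N + 2) * δ - b - c - d) k := by
    rw [sfac_succ_left]; congr 2; ring
  have e6 : sfac θ δ (a + (N + 1) * δ) (k + 1)
      = θ (a + (N + 1) * δ) * sfac θ δ (a + (N + 2) * δ) k := by
    rw [sfac_succ_left]; congr 2; ring
  rw [ftTerm, ftTerm, e1, e2, e3, e4, e5, e6, sfac_succ_left a, sfac_succ δ, sfac_succ_left b,
    sfac_succ_left c, sfac_succ_left d, sfac_succ_left (a + δ - b), sfac_succ_left (a + δ - c),
    sfac_succ_left (a + δ - d), sfac_succ (b + c + d - a - N * δ), sfac_succ (-(N * δ)), ftTerm,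
    mul_div_mul_comm (θ b), mul_div_mul_comm (θ c), mul_div_mul_comm (θ d), ftCoeff]
  convert key using 3
  · push_cast; ring_nf
  · push_cast; ring_nf
  · congr 3 <;> ring_nf

theorem ftValue_succ (hθ : IsFundamental θ) {N : ℕ} {a b c d : ℂ}
    (h : FTGeneric θ δ (N + 1) a b c d) :
    ftValue θ δ (N + 1) a b c d = ftValue θ δ N a b c d
      + ftCoeff θ δ N a b c d * ftValue θ δ N (a + 2 * δ) (b + δ) (c + δ) (d + δ) := by
  have hR := hθ.riemann_sub (a + (N + 1) * δ - (b + c) / 2) ((b + c) / 2)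
    (a + (N + 1) * δ - d - (b + c) / 2) ((c - b) / 2)
  have hP := sfac_succ_left (θ := θ) (δ := δ) (a + δ) (N + 1)
  have hB := sfac_succ_left (θ := θ) (δ := δ) (a + δ - b) N
  have hC := sfac_succ_left (θ := θ) (δ := δ) (a + δ - c) N
  have hD := sfac_succ_left (θ := θ) (δ := δ) (a + δ - d) N
  have hG := sfac_succ_left (θ := θ) (δ := δ) (a - b - c - d) N
  rw [sfac_succ] at hB hC hD hG
  rw [sfac_succ, sfac_succ, sfac_succ_left (a + δ + δ)] at hP
  have g0 : θ (a + δ - b - c - d + N * δ) = -θ (b + c + d - a - (N + 1) * δ) := by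
    rw [← hθ.map_neg]; congr 1; ring
  -- The factors of `[a+δ-b-c-d]_N` and of its shifted version are, up to sign, those of `bal` in
  -- reverse order, whence the indices `N - l` and `N + 1 - l` below.
  have hg : ∀ k : ℕ, k < 2 * N + 2 → ∀ x, x = a + δ - b - c - d + N * δ - k * δ → θ x ≠ 0 := by
    rintro k hk x rfl
    have := h.bal k (by omega)
    rw [← neg_ne_zero, ← hθ.map_neg] at this
    convert this using 2
    push_cast; ring
  have key := ftValue_succ_aux (P := sfac θ δ (a + δ) N)
    (p0 := θ (a + δ + N * δ)) (p1 := θ (a + (N + 2) * δ))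
    (a1 := θ (a + δ)) (a2 := θ (a + 2 * δ))
    (P' := sfac θ δ (a + 2 * δ + δ) N)
    (Q1 := sfac θ δ (a + δ - b - c) N) (Q2 := sfac θ δ (a + δ - b - d) N)
    (Q3 := sfac θ δ (a + δ - c - d) N)
    (q1 := θ (a + δ - b - c + N * δ)) (q2 := θ (a + δ - b - d + N * δ))
    (q3 := θ (a + δ - c - d + N * δ))
    (b0 := θ b) (c0 := θ c) (d0 := θ d) (X := θ (2 * a + (2 * N + 2) * δ - b - c - d))
    (Y := θ (b + c + d - a)) (g0 := θ (b + c + d - a - (N + 1) * δ))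
    (g1 := θ (b + c + d - a - N * δ))
    (by convert h.base (N + 1) (by omega) using 2; push_cast; ring)
    (by convert h.base (N + 2) (by omega) using 2; push_cast; ring)
    (by convert h.base 1 (by omega) using 2; push_cast; ring)
    (by convert h.base 2 (by omega) using 2; push_cast; ring)
    (by simpa using h.fst 0 (by omega)) (by simpa using h.snd 0 (by omega))
    (by simpa using h.trd 0 (by omega)) (h.fst N (by omega)) (h.snd N (by omega))
    (h.trd N (by omega)) (sfac_ne_zero fun l hl => h.fst l (by omega))
    (sfac_ne_zero fun l hl => h.snd l (by omega)) (sfac_ne_zero fun l hl => h.trd l (by omega))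
    (G := sfac θ δ (a + δ - b - c - d) N) (G' := sfac θ δ (a - b - c - d) N)
    (e0 := θ (a - b - c - d)) (e1 := θ (a - b - c - d + N * δ))
    (sfac_ne_zero fun l hl => hg (N - l) (by omega) _ (by
      rw [Nat.cast_sub hl.le]; ring))
    (sfac_ne_zero fun l hl => hg (N + 1 - l) (by omega) _ (by
      rw [Nat.cast_sub (by omega)]; push_cast; ring))
    (by convert h.bal 0 (by omega) using 2; push_cast; ring)
    (by convert h.bal 1 (by omega) using 2; push_cast; ring)
    (by convert h.bal (N + 1) (by omega) using 2; push_cast; ring)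
    (by rw [← mul_assoc] at hP; convert hP using 3 <;> push_cast <;> ring_nf) hB hC hD
    (by rw [hG]; congr 2; ring)
    (by rw [← hθ.map_neg]; congr 1; ring) (by rw [← hθ.map_neg]; congr 1; ring)
    (by rw [← g0, ← hθ.map_neg b]; convert hR using 4 <;> ring_nf)
  rw [ftValue, ftValue, ftValue, ftCoeff]
  simp only [sfac_succ]
  rw [g0]
  convert key using 3
  · congr 3; ring_nf
  · congr 1
    · congr 2
      · congr 2; ring
      · congr 1; ring
      · ring
    · congr 2
      · congr 1
        · congr 2; ring
        · congr 1; ring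
      · congr 1; ring
      · ring

/-- The Frenkel–Turaev summation. -/
theorem sum_ftTerm (hθ : IsFundamental θ) {N : ℕ} {a b c d : ℂ} (h : FTGeneric θ δ N a b c d) :
    ∑ k ∈ range (N + 1), ftTerm θ δ N a b c d k = ftValue θ δ N a b c d := by
  induction N generalizing a b c d with
  | zero =>
    have := h.base 0 (by simp)
    rw [Nat.cast_zero, zero_mul, add_zero] at this
    simp [ftTerm_zero this, ftValue]
  | succ N ih =>
    have ha := h.base 0 (by simp)
    rw [Nat.cast_zero, zero_mul, add_zero] at ha
    -- The recurrence relates terms with index `k + 1`, so the initial term is split off; in the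
    -- unshifted sum the extra term of index `N + 1` vanishes.
    rw [sum_range_succ', ftTerm_zero ha, ftValue_succ hθ h, ← ih h.pred, ← ih h.shift,
      sum_congr rfl fun k hk => ftTerm_succ hθ (Nat.lt_succ_iff.mp (mem_range.mp hk)) h,
      sum_add_distrib, ← mul_sum, sum_range_succ (fun k => ftTerm θ δ N a b c d (k + 1)),
      ftTerm_eq_zero hθ (Nat.lt_succ_self N), sum_range_succ' (ftTerm θ δ N a b c d),
      ftTerm_zero ha]
    ring

end FrenkelTuraev

/-! ### An interpolation determinant -/

section InterpolationDet

variable {θ : ℂ → ℂ} {δ : ℂ}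

/-- The matrix of the functions `[p±x]_j [q+jδ±x]_{N-j}` evaluated at the points `X_i`. -/
def ipMatrix (θ : ℂ → ℂ) (δ p q : ℂ) (X : ℕ → ℂ) (N : ℕ) :
    Matrix (Fin (N + 1)) (Fin (N + 1)) ℂ :=
  Matrix.of fun i j =>
    sfacPM θ δ p (X i) j * sfacPM θ δ (q + (j : ℕ) * δ) (X i) (N - j)

theorem sfacPM_succ (x y : ℂ) (k : ℕ) : sfacPM θ δ x y (k + 1)
    = sfacPM θ δ x y k * (θ (x + k * δ + y) * θ (x + k * δ - y)) := by
  rw [sfacPM, sfac_succ, sfac_succ, sfacPM, add_right_comm, sub_add_eq_add_sub]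
  ring

theorem sfacPM_succ_left (x y : ℂ) (k : ℕ) : sfacPM θ δ x y (k + 1)
    = θ (x + y) * θ (x - y) * sfacPM θ δ (x + δ) y k := by
  rw [sfacPM, sfac_succ_left, sfac_succ_left, sfacPM, add_right_comm, sub_add_eq_add_sub]
  ring

theorem sfacPM_eq_prod (x y : ℂ) (k : ℕ) : sfacPM θ δ x y k
    = ∏ l ∈ range k, (θ (x + l * δ + y) * θ (x + l * δ - y)) := by
  rw [sfacPM, sfac, sfac, ← prod_mul_distrib]
  refine prod_congr rfl fun l _ => ?_
  rw [add_right_comm, sub_add_eq_add_sub]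

/-- Elimination of the row `X 0`: from each column subtract the multiple of its predecessor that
cancels its value there. By the Riemann relation the new entries contain `[X_i ± X_0]`, and the
cofactor is a matrix of the same kind with `q` replaced by `q + δ`. -/
theorem det_ipMatrix_succ (hθ : IsFundamental θ) (p q : ℂ) (X : ℕ → ℂ) (N : ℕ)
    (h : ∀ j < N + 1, θ (q + j * δ + X 0) * θ (q + j * δ - X 0) ≠ 0) :
    (ipMatrix θ δ p q X (N + 1)).det
      = (∏ j ∈ range (N + 1), θ (p + q + 2 * j * δ) * θ (p - q)
          * (θ (X (j + 1) + X 0) * θ (X (j + 1) - X 0)))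
        * (ipMatrix θ δ p (q + δ) (fun i => X (i + 1)) N).det := by
  set pv : ℕ → ℂ := fun j => θ (q + j * δ + X 0) * θ (q + j * δ - X 0) with hpv
  -- The columns after elimination. The denominators `pv j` multiply up to the corner entry `[q ±
  -- X_0]_{N+1}` and cancel in the determinant.
  set B : Matrix (Fin (N + 1 + 1)) (Fin (N + 1 + 1)) ℂ := Matrix.of fun i =>
    Fin.cons (sfacPM θ δ q (X i) (N + 1)) fun j : Fin (N + 1) =>
      θ (X i + X 0) * θ (X i - X 0) * ((θ (p + q + 2 * (j : ℕ) * δ) * θ (p - q) / pv j)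
        * (sfacPM θ δ p (X i) j * sfacPM θ δ (q + δ + (j : ℕ) * δ) (X i) (N - j))) with hB
  have hAB : (ipMatrix θ δ p q X (N + 1)).det = B.det := by
    refine Matrix.det_eq_of_forall_col_eq_smul_add_pred
      (fun j => θ (p + (j : ℕ) * δ + X 0) * θ (p + (j : ℕ) * δ - X 0) / pv j) ?_ ?_
    · intro i
      simp [ipMatrix, hB, sfacPM]
    · intro i j
      have hj : θ (q + (j : ℕ) * δ + X 0) * θ (q + (j : ℕ) * δ - X 0) ≠ 0 := h j j.2
      have hR := hθ.riemann_sub (p + (j : ℕ) * δ) (X i) (q + (j : ℕ) * δ) (X 0)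
      have e1 : p + (j : ℕ) * δ + (q + (j : ℕ) * δ) = p + q + 2 * (j : ℕ) * δ := by ring
      have e2 : p + (j : ℕ) * δ - (q + (j : ℕ) * δ) = p - q := by ring
      rw [e1, e2, ← neg_sub (X i) (X 0), hθ.map_neg] at hR
      have e3 : N + 1 - (j : ℕ) = N - j + 1 := by omega
      have e4 : N + 1 - ((j : ℕ) + 1) = N - j := by omega
      have e5 : q + ((j : ℕ) + 1 : ℕ) * δ = q + δ + (j : ℕ) * δ := by push_cast; ring
      simp only [ipMatrix, hB, Matrix.of_apply, Fin.val_succ, Fin.val_castSucc, Fin.cons_succ, hpv]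
      rw [e3, e4, e5, sfacPM_succ, sfacPM_succ_left, add_right_comm q _ δ]
      generalize sfacPM θ δ p (X i) j = s1
      generalize sfacPM θ δ (q + δ + (j : ℕ) * δ) (X i) (N - j) = s2
      have hj1 := left_ne_zero_of_mul hj
      have hj2 := right_ne_zero_of_mul hj
      generalize θ (p + q + 2 * (j : ℕ) * δ) = t at hR ⊢
      field_simp
      linear_combination s1 * s2 * hR
  have h0 : ∀ j : Fin (N + 1), B 0 j.succ = 0 := fun j => by
    simp [hB, hθ.map_zero]
  have hm : B.submatrix Fin.succ (Fin.succAbove 0) = Matrix.of fun i j : Fin (N + 1) =>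
      (θ (X (i + 1) + X 0) * θ (X (i + 1) - X 0))
        * Matrix.of (fun i j : Fin (N + 1) => (θ (p + q + 2 * (j : ℕ) * δ) * θ (p - q) / pv j)
          * ipMatrix θ δ p (q + δ) (fun i => X (i + 1)) N i j) i j := by
    ext i j
    simp [hB, ipMatrix]
  have h00 : B 0 0 = ∏ j ∈ range (N + 1), pv j := by
    rw [← sfacPM_eq_prod]
    simp [hB]
  rw [hAB, Matrix.det_succ_row_zero, Fin.sum_univ_succ, sum_eq_zero fun j _ => by
    rw [h0, mul_zero, zero_mul], add_zero, hm, Matrix.det_mul_column, Matrix.det_mul_row, h00,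
    Fin.val_zero, pow_zero, one_mul,
    Fin.prod_univ_eq_prod_range (fun i => θ (X (i + 1) + X 0) * θ (X (i + 1) - X 0)),
    Fin.prod_univ_eq_prod_range (fun j => θ (p + q + 2 * (j : ℕ) * δ) * θ (p - q) / pv j),
    prod_div_distrib, prod_mul_distrib (g := fun j => θ (X (j + 1) + X 0) * θ (X (j + 1) - X 0))]
  have hpv0 : ∏ j ∈ range (N + 1), pv j ≠ 0 :=
    prod_ne_zero_iff.mpr fun j hj => h j (mem_range.mp hj)
  generalize ∏ j ∈ range (N + 1), θ (p + q + 2 * (j : ℕ) * δ) * θ (p - q) = Z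
  field_simp

theorem det_ipMatrix (hθ : IsFundamental θ) (p q : ℂ) (X : ℕ → ℂ) (N : ℕ)
    (h : ∀ i < N, ∀ j < N, θ (q + j * δ + X i) * θ (q + j * δ - X i) ≠ 0) :
    (ipMatrix θ δ p q X N).det
      = ∏ l ∈ range N, ∏ j ∈ range (N - l), (θ (p + q + (l + 2 * j) * δ) * θ (p - q - l * δ)
          * (θ (X (l + j + 1) + X l) * θ (X (l + j + 1) - X l))) := by
  induction N generalizing q X with
  | zero => simp [ipMatrix, sfacPM]
  | succ N ih =>
    rw [det_ipMatrix_succ hθ p q X N (h 0 (by omega)), ih]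
    · refine (mul_comm _ _).trans (Eq.trans ?_ (prod_range_succ' _ N).symm)
      congr 1
      · refine prod_congr rfl fun l _ => ?_
        rw [Nat.add_sub_add_right]
        refine prod_congr rfl fun j _ => ?_
        congr 1
        · congr 2 <;> push_cast <;> ring
        · rw [show l + 1 + j + 1 = l + j + 1 + 1 by ring]
      · refine prod_congr rfl fun j _ => ?_
        simp
    · intro i hi j hj
      convert h (i + 1) (by omega) (j + 1) (by omega) using 3 <;> push_cast <;> ring

end InterpolationDet

/-! ### The determinant of `L` -/

section DetL

variable {θ : ℂ → ℂ} {δ u a b c d : ℂ} {N : ℕ}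

/-! ### Nonvanishing of individual factors from genericity -/

namespace IsGeneric

theorem swap (h : IsGeneric θ δ u N a b c d) : IsGeneric θ δ u N c d a b where
  step := h.step
  base := h.base
  param p hp := h.param p (by simp only [List.mem_cons] at hp ⊢; tauto)
  pair_ab := h.pair_cd
  pair_cd := h.pair_ab

theorem two_mul_ne (h : IsGeneric θ δ u N a b c d) {x : ℂ} (k : ℤ)
    (hk : -(2 * N : ℤ) ≤ k ∧ k ≤ 2 * N) (hx : x = 2 * u + k * δ) : θ x ≠ 0 :=
  hx ▸ h.base k (abs_le.mpr hk)

theorem add_fst_ne (h : IsGeneric θ δ u N a b c d) {x : ℂ} (k : ℤ)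
    (hk : -(2 * N : ℤ) ≤ k ∧ k ≤ 2 * N) (hx : x = u + a + k * δ) : θ x ≠ 0 :=
  hx ▸ (h.param a (by simp) k (abs_le.mpr hk)).1

theorem sub_fst_ne (h : IsGeneric θ δ u N a b c d) {x : ℂ} (k : ℤ)
    (hk : -(2 * N : ℤ) ≤ k ∧ k ≤ 2 * N) (hx : x = u - a + k * δ) : θ x ≠ 0 :=
  hx ▸ (h.param a (by simp) k (abs_le.mpr hk)).2

theorem add_snd_ne (h : IsGeneric θ δ u N a b c d) {x : ℂ} (k : ℤ)
    (hk : -(2 * N : ℤ) ≤ k ∧ k ≤ 2 * N) (hx : x = u + b + k * δ) : θ x ≠ 0 :=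
  hx ▸ (h.param b (by simp) k (abs_le.mpr hk)).1

theorem sub_snd_ne (h : IsGeneric θ δ u N a b c d) {x : ℂ} (k : ℤ)
    (hk : -(2 * N : ℤ) ≤ k ∧ k ≤ 2 * N) (hx : x = u - b + k * δ) : θ x ≠ 0 :=
  hx ▸ (h.param b (by simp) k (abs_le.mpr hk)).2

theorem fst_add_snd_ne (h : IsGeneric θ δ u N a b c d) {x : ℂ} (k : ℤ)
    (hk : -(2 * N : ℤ) ≤ k ∧ k ≤ 2 * N) (hx : x = a + b + k * δ) : θ x ≠ 0 :=
  hx ▸ (h.pair_ab k (abs_le.mpr hk)).1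

theorem fst_sub_snd_ne (h : IsGeneric θ δ u N a b c d) {x : ℂ} (k : ℤ)
    (hk : -(2 * N : ℤ) ≤ k ∧ k ≤ 2 * N) (hx : x = a - b + k * δ) : θ x ≠ 0 :=
  hx ▸ (h.pair_ab k (abs_le.mpr hk)).2

theorem step_ne (h : IsGeneric θ δ u N a b c d) {k : ℕ} (hk : k < N) : θ (δ + k * δ) ≠ 0 := by
  convert h.step (k + 1) (by omega) (by omega) using 2
  push_cast; ring

theorem sfac_step_ne (h : IsGeneric θ δ u N a b c d) {k : ℕ} (hk : k ≤ N) : sfac θ δ δ k ≠ 0 :=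
  sfac_ne_zero fun _ hl => h.step_ne (by omega)

end IsGeneric

/-- Regroups the triangular product by `k = l + j`, since each fixed `k` will give the four shifted
factorials of length `k + 1` in `valueDetL`. -/
theorem prod_triangle (N : ℕ) (F : ℕ → ℕ → ℂ) :
    ∏ l ∈ range N, ∏ j ∈ range (N - l), F l j
      = ∏ k ∈ range N, ∏ l ∈ range (k + 1), F l (k - l) := by
  have h : ∀ l ∈ range N, ∏ j ∈ range (N - l), F l j = ∏ k ∈ Ico l N, F l (k - l) := by
    intro l _
    rw [prod_Ico_eq_prod_range]
    exact prod_congr rfl fun j _ => by rw [Nat.add_sub_cancel_left]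
  rw [prod_congr rfl h]
  refine prod_comm' fun l k => ?_
  simp only [mem_range, mem_Ico]
  omega

/-- The factor of the entries of `L` that depends only on the column. -/
def colL (θ : ℂ → ℂ) (δ u : ℂ) (N : ℕ) (c d : ℂ) (j : ℕ) : ℂ :=
  θ (2 * u + 2 * j * δ) / θ (2 * u)
    * (sfac θ δ (2 * u) j * sfac θ δ (-(N * δ)) j * sfac θ δ (u + c) j * sfac θ δ (u - d + δ) j
      / (sfac θ δ δ j * sfac θ δ (2 * u + (N + 1) * δ) j
        * sfac θ δ (u - c + δ) j * sfac θ δ (u + d) j))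

/-- The reciprocal of the common denominator of the `i`-th row of `L`. -/
def rowL (θ : ℂ → ℂ) (δ u : ℂ) (N : ℕ) (c d : ℂ) (i : ℕ) : ℂ :=
  sfac θ δ (u + c - i * δ) N * sfac θ δ (u - d - (N - 2 - i) * δ) N

theorem rowL_ne_zero (h : IsGeneric θ δ u N c d a b) {i : ℕ} (hi : i ≤ N) :
    rowL θ δ u N c d i ≠ 0 :=
  mul_ne_zero
    (sfac_ne_zero fun l hl => h.add_fst_ne (l - i) (by omega) (by push_cast; ring))
    (sfac_ne_zero fun l hl => h.sub_snd_ne (l + i + 2 - N) (by omega) (by push_cast; ring))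

theorem colL_ne_zero (hθ : IsFundamental θ) (h : IsGeneric θ δ u N c d a b) {j : ℕ} (hj : j ≤ N) :
    colL θ δ u N c d j ≠ 0 := by
  refine mul_ne_zero (div_ne_zero ?_ ?_) (div_ne_zero ?_ ?_)
  · exact h.two_mul_ne (2 * j) (by omega) (by push_cast; ring)
  · exact h.two_mul_ne 0 (by omega) (by push_cast; ring)
  · refine mul_ne_zero (mul_ne_zero (mul_ne_zero ?_ ?_) ?_) ?_
    · exact sfac_ne_zero fun l hl => h.two_mul_ne l (by omega) (by push_cast; ring)
    · refine sfac_ne_zero fun l hl => ?_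
      rw [← neg_ne_zero, ← hθ.map_neg]
      convert h.step (N - l) (by omega) (by omega) using 2
      rw [Nat.cast_sub (by omega)]
      ring
    · exact sfac_ne_zero fun l hl => h.add_fst_ne l (by omega) (by push_cast; ring)
    · exact sfac_ne_zero fun l hl => h.sub_snd_ne (l + 1) (by omega) (by push_cast; ring)
  · refine mul_ne_zero (mul_ne_zero (mul_ne_zero ?_ ?_) ?_) ?_
    · exact h.sfac_step_ne hj
    · exact sfac_ne_zero fun l hl => h.two_mul_ne (l + N + 1) (by omega) (by push_cast; ring)
    · exact sfac_ne_zero fun l hl => h.sub_fst_ne (l + 1) (by omega) (by push_cast; ring)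
    · exact sfac_ne_zero fun l hl => h.add_snd_ne l (by omega) (by push_cast; ring)

/-- The two row-dependent numerator parameters have a sum `2p` free of `i`, and so do the two
matching denominator parameters, with sum `2q`; both pairs have the same difference `2X_i`.
Completing the denominators from length `j` to length `N` leaves `[q+jδ±X_i]_{N-j}` in the
numerator. -/
theorem matL_eq (h : IsGeneric θ δ u N c d a b) :
    matL θ δ u N c d = Matrix.of fun i j : Fin (N + 1) => (rowL θ δ u N c d i)⁻¹
      * Matrix.of (fun i j : Fin (N + 1) => colL θ δ u N c d j
        * ipMatrix θ δ ((2 * u - c + d + N * δ) / 2) ((2 * u + c - d - (N - 2) * δ) / 2)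
            (fun i => (-c - d + (2 - N) * δ) / 2 + i * δ) N i j) i j := by
  ext i j
  obtain ⟨i, hi⟩ := i
  obtain ⟨j, hj⟩ := j
  have hr := rowL_ne_zero h (Nat.lt_succ_iff.mp hi)
  have hN : N = j + (N - j) := by omega
  have e1 : sfac θ δ (u + c - i * δ) N
      = sfac θ δ (u + c - i * δ) j * sfac θ δ (u + c - i * δ + j * δ) (N - j) := by
    rw [← sfac_add, ← hN]
  have e2 : sfac θ δ (u - d - (N - 2 - i) * δ) N = sfac θ δ (u - d - (N - 2 - i) * δ) j
      * sfac θ δ (u - d - (N - 2 - i) * δ + j * δ) (N - j) := by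
    rw [← sfac_add, ← hN]
  have e3 : (2 * u - c + d + N * δ) / 2 + ((-c - d + (2 - N) * δ) / 2 + i * δ)
      = u - c + (1 + i) * δ := by ring
  have e4 : (2 * u - c + d + N * δ) / 2 - ((-c - d + (2 - N) * δ) / 2 + i * δ)
      = u + d + (N - 1 - i) * δ := by ring
  have e5 : (2 * u + c - d - (N - 2) * δ) / 2 + j * δ + ((-c - d + (2 - N) * δ) / 2 + i * δ)
      = u - d - (N - 2 - i) * δ + j * δ := by ring
  have e6 : (2 * u + c - d - (N - 2) * δ) / 2 + j * δ - ((-c - d + (2 - N) * δ) / 2 + i * δ)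
      = u + c - i * δ + j * δ := by ring
  have e7 : δ + 2 * u - (u - c + (1 + i) * δ) = u + c - i * δ := by ring
  have e8 : δ + 2 * u - (u + d + (N - 1 - i) * δ) = u - d - (N - 2 - i) * δ := by ring
  have e9 : δ + 2 * u - -(N * δ) = 2 * u + (N + 1) * δ := by ring
  have e10 : δ + 2 * u - (u + c) = u - c + δ := by ring
  have e11 : δ + 2 * u - (u - d + δ) = u + d := by ring
  simp only [matL, ipMatrix, vterm, Matrix.of_apply, List.map_cons, List.map_nil, List.prod_cons,
    List.prod_nil, sfacPM, e3, e4, e5, e6, e7, e8, e9, e10, e11]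
  rw [rowL, e1, e2] at hr ⊢
  have h1 := right_ne_zero_of_mul (left_ne_zero_of_mul hr)
  have h2 := right_ne_zero_of_mul (right_ne_zero_of_mul hr)
  rw [colL]
  generalize sfac θ δ (u + c - i * δ + j * δ) (N - j) = s1 at *
  generalize sfac θ δ (u - d - (N - 2 - i) * δ + j * δ) (N - j) = s2 at *
  generalize sfac θ δ (u + c - i * δ) j = s3 at *
  generalize sfac θ δ (u - d - (N - 2 - i) * δ) j = s4 at *
  generalize sfac θ δ (u - c + (1 + i) * δ) j = s5
  generalize sfac θ δ (u + d + (N - 1 - i) * δ) j = s6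
  generalize sfac θ δ (2 * u) j = s7
  generalize θ (2 * u + 2 * j * δ) / θ (2 * u) = s8
  generalize sfac θ δ δ j = s9
  have h3 : s1⁻¹ * s1 = 1 := inv_mul_cancel₀ h1
  have h4 : s2⁻¹ * s2 = 1 := inv_mul_cancel₀ h2
  simp only [div_eq_mul_inv, mul_inv]
  linear_combination (-(s5 * s6 * s7 * s8 * s9⁻¹ * s3⁻¹ * s4⁻¹ * sfac θ δ (-(N * δ)) j
    * (sfac θ δ (2 * u + (N + 1) * δ) j)⁻¹ * sfac θ δ (u + c) j * (sfac θ δ (u - c + δ) j)⁻¹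
    * sfac θ δ (u - d + δ) j * (sfac θ δ (u + d) j)⁻¹)) * (s2⁻¹ * s2 * h3 + h4)

theorem sfac_eq_prod_reflect (x : ℂ) (k : ℕ) :
    sfac θ δ x (k + 1) = ∏ l ∈ range (k + 1), θ (x + (k - l) * δ) := by
  rw [sfac, ← prod_range_reflect]
  refine prod_congr rfl fun l hl => ?_
  rw [Nat.add_sub_cancel, Nat.cast_sub (Nat.lt_succ_iff.mp (mem_range.mp hl))]

theorem prod_ipMatrix_row (hθ : IsFundamental θ) (N k : ℕ) (X : ℕ → ℂ) (c d u p q : ℂ)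
    (hpq : p + q = 2 * u + δ) (hpq' : p - q = d - c + (N - 1) * δ)
    (hX : ∀ i, X i = (-c - d + (2 - N) * δ) / 2 + i * δ) :
    ∏ l ∈ range (k + 1), (θ (p + q + (l + 2 * (k - l : ℕ)) * δ) * θ (p - q - l * δ)
        * (θ (X (l + (k - l) + 1) + X l) * θ (X (l + (k - l) + 1) - X l)))
      = sfac θ δ δ (k + 1) * sfac θ δ (c + d + (N - 1 - 2 * (k + 1 : ℕ)) * δ) (k + 1)
        * sfac θ δ (c - d - (N - 1) * δ) (k + 1) * sfac θ δ (2 * u + (k + 1 : ℕ) * δ) (k + 1) := by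
  rw [sfac_eq_prod_reflect δ, sfac_eq_prod_reflect (c + d + _), sfac_eq_prod_reflect (2 * u + _),
    sfac, ← prod_mul_distrib, ← prod_mul_distrib, ← prod_mul_distrib]
  refine prod_congr rfl fun l hl => ?_
  have hl' : l ≤ k := Nat.lt_succ_iff.mp (mem_range.mp hl)
  rw [Nat.add_sub_cancel' hl', Nat.cast_sub hl', hpq, hpq', hX, hX]
  push_cast
  have e1 : d - c + (N - 1) * δ - l * δ = -(c - d - (N - 1) * δ + l * δ) := by ring
  have e2 : (-c - d + (2 - N) * δ) / 2 + (k + 1) * δ + ((-c - d + (2 - N) * δ) / 2 + l * δ)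
      = -(c + d + (N - 1 - 2 * (k + 1)) * δ + (k - l) * δ) := by ring
  have e3 : (-c - d + (2 - N) * δ) / 2 + (k + 1) * δ - ((-c - d + (2 - N) * δ) / 2 + l * δ)
      = δ + (k - l) * δ := by ring
  have e4 : 2 * u + δ + (l + 2 * (k - l)) * δ = 2 * u + (k + 1) * δ + (k - l) * δ := by ring
  rw [e1, e2, e3, e4, hθ.map_neg, hθ.map_neg]
  ring

theorem det_matL (hθ : IsFundamental θ) (h : IsGeneric θ δ u N c d a b) :
    (matL θ δ u N c d).det = valueDetL θ δ u N c d := by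
  rw [matL_eq h, Matrix.det_mul_column, Matrix.det_mul_row, det_ipMatrix hθ, prod_triangle,
    Fin.prod_univ_eq_prod_range (fun i => (rowL θ δ u N c d i)⁻¹),
    Fin.prod_univ_eq_prod_range (colL θ δ u N c d), prod_inv_distrib, valueDetL]
  · rw [mul_comm (∏ j ∈ range (N + 1), colL θ δ u N c d j), ← mul_assoc, ← div_eq_inv_mul]
    congr 2
    rw [← Ico_add_one_right_eq_Icc, prod_Ico_eq_prod_range, Nat.add_sub_cancel]
    refine prod_congr rfl fun k _ => ?_
    rw [prod_ipMatrix_row hθ N k _ c d u _ _ (by ring) (by ring) fun _ => rfl, add_comm 1 k]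
  · intro i hi j hj
    refine mul_ne_zero ?_ ?_
    · exact h.sub_snd_ne (i + j + 2 - N) (by omega) (by push_cast; ring)
    · exact h.add_fst_ne (j - i) (by omega) (by push_cast; ring)

theorem valueDetL_ne_zero (hθ : IsFundamental θ) (h : IsGeneric θ δ u N c d a b) :
    valueDetL θ δ u N c d ≠ 0 := by
  refine mul_ne_zero (div_ne_zero ?_ ?_) ?_
  · refine prod_ne_zero_iff.mpr fun j hj => ?_
    obtain ⟨hj1, hj2⟩ := mem_Icc.mp hj
    refine mul_ne_zero (mul_ne_zero (mul_ne_zero ?_ ?_) ?_) ?_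
    · exact h.sfac_step_ne hj2
    · exact sfac_ne_zero fun l hl => h.fst_add_snd_ne (N - 1 - 2 * j + l) (by omega)
        (by push_cast; ring)
    · exact sfac_ne_zero fun l hl => h.fst_sub_snd_ne (l - (N - 1)) (by omega) (by push_cast; ring)
    · exact sfac_ne_zero fun l hl => h.two_mul_ne (j + l) (by omega) (by push_cast; ring)
  · exact prod_ne_zero_iff.mpr fun i hi => rowL_ne_zero h (Nat.lt_succ_iff.mp (mem_range.mp hi))
  · exact prod_ne_zero_iff.mpr fun j hj => colL_ne_zero hθ h (Nat.lt_succ_iff.mp (mem_range.mp hj))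

end DetL

/-! ### The product `LG` -/

section ProductLG

variable {θ : ℂ → ℂ} {δ u a b c d : ℂ} {N : ℕ}

/-- Splitting a factorial of length `j + k` in the two possible orders trades a shift of the
argument by `k` for one by `j`. -/
theorem sfacPM_refPt (hθ : IsFundamental θ) (p : ℂ) (j k : ℕ)
    (h1 : sfac θ δ (u + p) k ≠ 0) (h2 : sfac θ δ (u - p + δ - j * δ) k ≠ 0) :
    sfacPM θ δ p (refPt δ u k) j = sfacPM θ δ p u j
      * (sfac θ δ (u + p + j * δ) k / sfac θ δ (u + p) k)
      * (sfac θ δ (u - p + δ) k / sfac θ δ (u - p + δ - j * δ) k) := by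
  have e1 := sfac_add (θ := θ) (δ := δ) (u + p) k j
  rw [add_comm k j, sfac_add] at e1
  have e2 := sfac_add (θ := θ) (δ := δ) (p - (u + k * δ)) k j
  rw [add_comm k j, sfac_add, sfac_reflect hθ (x := p - (u + k * δ) + j * δ)
    (y := u - p + δ - j * δ) (by ring), sfac_reflect hθ (x := p - (u + k * δ)) (k := k)
    (y := u - p + δ) (by ring), show p - (u + k * δ) + k * δ = p - u by ring] at e2
  have e3 : sfac θ δ (p - (u + k * δ)) j * sfac θ δ (u - p + δ - j * δ) k
      = sfac θ δ (u - p + δ) k * sfac θ δ (p - u) j := by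
    have hs : ((-1 : ℂ) ^ k) ≠ 0 := pow_ne_zero _ (by norm_num)
    apply mul_left_cancel₀ hs
    linear_combination e2
  rw [sfacPM, sfacPM, refPt, show p + (u + k * δ) = u + p + k * δ by ring, add_comm p u]
  generalize sfac θ δ (u - p + δ - j * δ) k = t at *
  generalize sfac θ δ (u + p + j * δ) k = s at *
  field_simp
  linear_combination sfac θ δ (u + p) j * s * e3 - t * sfac θ δ (p - (u + k * δ)) j * e1

/-- The denominators are left as `δ + 2u - x` to show the well-poised pairing, so these factors join
those of `vterm` with base `2u`. -/
theorem basisFun_refPt (hθ : IsFundamental θ) (h : IsGeneric θ δ u N a b c d) {j k : ℕ}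
    (hj : j ≤ N) (hk : k ≤ N) :
    basisFun θ δ a b j (refPt δ u k) = sfacPM θ δ a u j / sfacPM θ δ b u j
      * (sfac θ δ (u + a + j * δ) k / sfac θ δ (δ + 2 * u - (u + a + j * δ)) k
        * (sfac θ δ (u - b + δ - j * δ) k / sfac θ δ (δ + 2 * u - (u - b + δ - j * δ)) k)
        * (sfac θ δ (u - a + δ) k / sfac θ δ (δ + 2 * u - (u - a + δ)) k)
        * (sfac θ δ (u + b) k / sfac θ δ (δ + 2 * u - (u + b)) k)) := by
  rw [basisFun, sfacPM_refPt hθ a j k, sfacPM_refPt hθ b j k,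
    show δ + 2 * u - (u + a + j * δ) = u - a + δ - j * δ by ring,
    show δ + 2 * u - (u - b + δ - j * δ) = u + b + j * δ by ring,
    show δ + 2 * u - (u - a + δ) = u + a by ring, show δ + 2 * u - (u + b) = u - b + δ by ring]
  · simp only [div_eq_mul_inv, mul_inv, inv_inv]
    ring
  · exact sfac_ne_zero fun l hl => h.add_snd_ne l (by omega) (by push_cast; ring)
  · exact sfac_ne_zero fun l hl => h.sub_snd_ne (l + 1 - j) (by omega) (by push_cast; ring)
  · exact sfac_ne_zero fun l hl => h.add_fst_ne l (by omega) (by push_cast; ring)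
  · exact sfac_ne_zero fun l hl => h.sub_fst_ne (l + 1 - j) (by omega) (by push_cast; ring)

/-- The entries of `L`, indexed by natural numbers. -/
def entryL (θ : ℂ → ℂ) (δ u : ℂ) (N : ℕ) (c d : ℂ) (i j : ℕ) : ℂ :=
  vterm θ δ (2 * u)
    [-(N * δ), u - c + (1 + i) * δ, u + d + (N - 1 - i) * δ, u + c, u - d + δ] j

/-- The parameters `u + c`, `u - d + δ` of `L` cancel against `u - c + δ`, `u + d` from `g_j`. The
last parameter left, `u + c + jδ`, is the one prescribed by the balancing condition. -/
theorem entryL_mul_basisFun (hθ : IsFundamental θ) (h : IsGeneric θ δ u N c d a b) {i j k : ℕ}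
    (hj : j ≤ N) (hk : k ≤ N) :
    entryL θ δ u N c d i k * basisFun θ δ c d j (refPt δ u k)
      = sfacPM θ δ c u j / sfacPM θ δ d u j
        * ftTerm θ δ N (2 * u) (u - c + (1 + i) * δ) (u + d + (N - 1 - i) * δ)
            (u - d + δ - j * δ) k := by
  rw [basisFun_refPt hθ h hj hk, entryL, ftTerm, vterm]
  have h1 : sfac θ δ (u + c) k ≠ 0 :=
    sfac_ne_zero fun l hl => h.add_fst_ne l (by omega) (by push_cast; ring)
  have h2 : sfac θ δ (u - c + δ) k ≠ 0 :=
    sfac_ne_zero fun l hl => h.sub_fst_ne (l + 1) (by omega) (by push_cast; ring)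
  have h3 : sfac θ δ (u + d) k ≠ 0 :=
    sfac_ne_zero fun l hl => h.add_snd_ne l (by omega) (by push_cast; ring)
  have h4 : sfac θ δ (u - d + δ) k ≠ 0 :=
    sfac_ne_zero fun l hl => h.sub_snd_ne (l + 1) (by omega) (by push_cast; ring)
  rw [show δ + 2 * u - (u + c + j * δ) = u - c + δ - j * δ by ring,
    show δ + 2 * u - (u - c + δ) = u + c by ring, show δ + 2 * u - (u + d) = u - d + δ by ring,
    show 2 * (2 * u) + (N + 1) * δ - (u - c + (1 + i) * δ) - (u + d + (N - 1 - i) * δ)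
      - (u - d + δ - j * δ) = u + c + j * δ by ring,
    show u - c + (1 + i) * δ + (u + d + (N - 1 - i) * δ) + (u - d + δ - j * δ) - 2 * u - N * δ
      = u - c + δ - j * δ by ring, add_comm (2 * u) δ]
  simp only [List.map_cons, List.map_nil, List.prod_cons, List.prod_nil]
  rw [show δ + 2 * u - (u + c) = u - c + δ by ring, show δ + 2 * u - (u - d + δ) = u + d by ring,
    show δ + 2 * u - -(N * δ) = 2 * u + (N + 1) * δ by ring]
  have hc : sfac θ δ (u + c) k / sfac θ δ (u - c + δ) k
      * (sfac θ δ (u - c + δ) k / sfac θ δ (u + c) k) = 1 := by field_simp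
  have hd : sfac θ δ (u - d + δ) k / sfac θ δ (u + d) k
      * (sfac θ δ (u + d) k / sfac θ δ (u - d + δ) k) = 1 := by field_simp
  generalize sfac θ δ (u + c) k / sfac θ δ (u - c + δ) k = x1 at *
  generalize sfac θ δ (u - c + δ) k / sfac θ δ (u + c) k = x2 at *
  generalize sfac θ δ (u - d + δ) k / sfac θ δ (u + d) k = x3 at *
  generalize sfac θ δ (u + d) k / sfac θ δ (u - d + δ) k = x4 at *
  have key : ∀ A B : ℂ, A = B * (x1 * x2 * (x3 * x4)) → A = B := fun A B hAB => by
    rw [hAB, hc, hd, one_mul, mul_one]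
  apply key
  ring

theorem sum_entryL_mul_basisFun (hθ : IsFundamental θ) (h : IsGeneric θ δ u N c d a b) {i j : ℕ}
    (hi : i ≤ N) (hj : j ≤ N) :
    ∑ k ∈ range (N + 1), entryL θ δ u N c d i k * basisFun θ δ c d j (refPt δ u k)
      = valueLG θ δ u N c d i j := by
  rw [sum_congr rfl fun k hk =>
      entryL_mul_basisFun hθ h (i := i) hj (Nat.lt_succ_iff.mp (mem_range.mp hk)),
    ← mul_sum, sum_ftTerm hθ, mul_comm, valueLG, ftValue]
  · congr 1
    -- Two factors of the numerator and two of the denominator are reflected, so the four signs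
    -- `(-1)^N` cancel.
    rw [sfac_reflect hθ (x := 2 * u + δ - (u - c + (1 + i) * δ) - (u + d + (N - 1 - i) * δ))
        (y := d - c) (by ring),
      show 2 * u + δ - (u - c + (1 + i) * δ) - (u - d + δ - j * δ) = c + d + (j - i - 1) * δ by
        ring,
      sfac_reflect hθ (x := 2 * u + δ - (u + d + (N - 1 - i) * δ) - (u - d + δ - j * δ))
        (y := -((i + j) * δ)) (by ring),
      show 2 * u + δ - (u - c + (1 + i) * δ) = u + c - i * δ by ring,
      sfac_reflect hθ (x := 2 * u + δ - (u + d + (N - 1 - i) * δ))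
        (y := -u + d - (1 + i) * δ) (by ring),
      show 2 * u + δ - (u - d + δ - j * δ) = u + d + j * δ by ring,
      sfac_reflect hθ (x := u + c - i * δ - (u + d + (N - 1 - i) * δ) - (u - d + δ - j * δ))
        (y := u - c + (1 - j) * δ) (by ring)]
    have hs : ((-1 : ℂ) ^ N) * (-1) ^ N = 1 := by rw [← mul_pow]; simp
    have hs' : (((-1 : ℂ) ^ N))⁻¹ * ((-1) ^ N)⁻¹ = 1 := by rw [← mul_inv, hs, inv_one]
    generalize (-1 : ℂ) ^ N = s at hs hs' ⊢
    have key : ∀ A B : ℂ, A = B * (s * s * (s⁻¹ * s⁻¹)) → A = B := fun A B hAB => by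
      rw [hAB, hs, hs', one_mul, mul_one]
    apply key
    simp only [div_eq_mul_inv, mul_inv]
    ring
  · exact {
      step := fun k hk => h.step_ne hk
      base := fun k hk => h.two_mul_ne k (by omega) (by push_cast; ring)
      fst := fun k hk => h.add_fst_ne (k - i) (by omega) (by push_cast; ring)
      snd := fun k hk => h.sub_snd_ne (k + i + 2 - N) (by omega) (by push_cast; ring)
      trd := fun k hk => h.add_snd_ne (k + j) (by omega) (by push_cast; ring)
      bal := fun k hk => h.sub_fst_ne (k + 1 - j) (by omega) (by push_cast; ring) }

theorem matL_mul_matG (hθ : IsFundamental θ) (h : IsGeneric θ δ u N c d a b) {n : ℕ} (hn : n ≤ N)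
    (i : Fin (N + 1)) (j : Fin (n + 1)) :
    (matL θ δ u N c d * matG θ δ u N n c d) i j = valueLG θ δ u N c d i j := by
  rw [← sum_entryL_mul_basisFun hθ h (by omega) (by omega), Matrix.mul_apply,
    ← Fin.sum_univ_eq_sum_range (fun k => entryL θ δ u N c d i k
      * basisFun θ δ c d j (refPt δ u k))]
  rfl

theorem valueLG_eq_zero (hθ : IsFundamental θ) {i j : ℕ} (h : i + j < N) :
    valueLG θ δ u N c d i j = 0 := by
  have := sfac_neg_eq_zero (δ := δ) hθ h
  rw [Nat.cast_add] at this
  simp [valueLG, this]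

/-- Only the last entry of the first row survives the expansion, and its signs accumulate to
`(-1)^(n.choose 2)`. -/
theorem det_antitriangular {R : Type*} [CommRing R] {n : ℕ} (A : Matrix (Fin n) (Fin n) R)
    (h : ∀ i j : Fin n, (i : ℕ) + j + 1 < n → A i j = 0) :
    A.det = (-1) ^ n.choose 2 * ∏ j, A j.rev j := by
  induction n with
  | zero => simp
  | succ n ih =>
    rw [Matrix.det_succ_row_zero, Fin.sum_univ_castSucc, sum_eq_zero, zero_add,
      Fin.succAbove_last, ih, Fin.prod_univ_castSucc, Nat.choose_succ_succ' n 1, Nat.choose_one_right,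
      pow_add, Fin.rev_last, Fin.val_last]
    · simp only [Matrix.submatrix_apply, Fin.rev_castSucc]
      ring
    · intro i j hij
      exact h _ _ (by simp; omega)
    · intro j _
      rw [h 0 j.castSucc (by simp), mul_zero, zero_mul]

theorem det_matM (hθ : IsFundamental θ) {m n : ℕ} (h : IsGeneric θ δ u (m + n) c d a b) :
    (matM θ δ u m n c d).det = valueDetM θ δ u (m + n) n c d := by
  have hM : ∀ i j, matM θ δ u m n c d i j = valueLG θ δ u (m + n) c d (m + i : ℕ) j := fun i j => by
    rw [matM, Matrix.of_apply, matL_mul_matG hθ h (by omega)]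
    rfl
  rw [det_antitriangular, valueDetM, mul_assoc, ← prod_mul_distrib,
    ← Fin.prod_univ_eq_prod_range (fun j : ℕ => sfacPM θ δ c u j / sfacPM θ δ d u j * _)]
  · congr 1
    refine prod_congr rfl fun j _ => ?_
    have e : ((m + (j.rev : ℕ) : ℕ) : ℂ) = (m + n : ℕ) - (j : ℕ) := by
      rw [Fin.val_rev, ← Nat.cast_sub (by omega)]
      congr 1
      omega
    rw [hM, valueLG, mul_comm, e]
    congr 2
    · congr 3
      · congr 2; ring
      · congr 1; ring
    · congr 2; ring
  · intro i j hij
    rw [hM, valueLG_eq_zero hθ (by omega)]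

end ProductLG

/-! ### Determinant identities for the Padé matrices -/

section PadeMatrix

theorem finRotate_pow_val (N p : ℕ) (i : Fin (N + 1)) :
    (((finRotate (N + 1)) ^ p) i : ℕ) = (i + p) % (N + 1) := by
  induction p with
  | zero => simp [Nat.mod_eq_of_lt i.2]
  | succ p ih =>
    rw [pow_succ', Equiv.Perm.mul_apply, finRotate_apply, Fin.val_add, ih, Fin.val_one',
      ← Nat.add_mod, add_assoc]

/-- Interchanging two adjacent blocks is a power of the cyclic rotation, whose sign is `(-1)^N`. -/
theorem sign_of_val_eq_add_mod {N p : ℕ} (σ : Equiv.Perm (Fin (N + 1)))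
    (h : ∀ i, (σ i : ℕ) = (i + p) % (N + 1)) : Equiv.Perm.sign σ = (-1) ^ (N * p) := by
  have : σ = (finRotate (N + 1)) ^ p := Equiv.ext fun i => Fin.ext (by rw [h, finRotate_pow_val])
  rw [this, map_pow, sign_finRotate, Nat.add_sub_cancel, pow_mul]

section Entries

variable (m n : ℕ) (f g : ℕ → ℂ → ℂ) (pt lam mu : ℕ → ℂ) (s : Fin (m + 1) → ℂ)
  (t : Fin (n + 1) → ℂ)

theorem padeMatrix_zero_castAdd (j : Fin (m + 1)) :
    padeMatrix m n f g pt lam mu s t 0 (Fin.castAdd (n + 1) j) = s j :=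
  Fin.append_left (m := m + 1) (n := n + 1) s t j

theorem padeMatrix_zero_natAdd (j : Fin (n + 1)) :
    padeMatrix m n f g pt lam mu s t 0 (Fin.natAdd (m + 1) j) = t j :=
  Fin.append_right (m := m + 1) (n := n + 1) s t j

theorem padeMatrix_succ_castAdd (i : Fin (m + 1 + n)) (j : Fin (m + 1)) :
    padeMatrix m n f g pt lam mu s t i.succ (Fin.castAdd (n + 1) j) = mu i * f j (pt i) :=
  Fin.append_left (m := m + 1) (n := n + 1) (fun j => mu i * f j (pt i))
    (fun j => lam i * g j (pt i)) j

theorem padeMatrix_succ_natAdd (i : Fin (m + 1 + n)) (j : Fin (n + 1)) :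
    padeMatrix m n f g pt lam mu s t i.succ (Fin.natAdd (m + 1) j) = lam i * g j (pt i) :=
  Fin.append_right (m := m + 1) (n := n + 1) (fun j => mu i * f j (pt i))
    (fun j => lam i * g j (pt i)) j

end Entries

theorem finAddFlip_val (m n : ℕ) (k : Fin (n + m)) :
    ((finAddFlip k : Fin (m + n)) : ℕ) = (k + m) % (m + n) := by
  refine Fin.addCases (fun k => ?_) (fun k => ?_) k
  · rw [finAddFlip_apply_castAdd, Fin.val_natAdd, Fin.val_castAdd, Nat.mod_eq_of_lt (by omega),
      add_comm]
  · rw [finAddFlip_apply_natAdd, Fin.val_natAdd, Fin.val_castAdd,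
      show n + k + m = k + (m + n) by ring, Nat.add_mod_right, Nat.mod_eq_of_lt (by omega)]

/-- This reduces the formula for `Q_n` to that for `P_m`. -/
theorem det_padeMatrix_swap (m n : ℕ) (f g : ℕ → ℂ → ℂ) (pt lam mu : ℕ → ℂ)
    (s : Fin (m + 1) → ℂ) (t : Fin (n + 1) → ℂ) :
    (padeMatrix m n f g pt lam mu s t).det
      = (-1) ^ ((m + 1 + n) * (m + 1)) * (padeMatrix n m g f pt mu lam t s).det := by
  -- `e` preserves values and only matches the two index types, while `φ` flips the blocks; the
  -- permutation to be signed is their discrepancy.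
  set e : Fin (n + 1 + m + 1) ≃ Fin (m + 1 + n + 1) := finCongr (by ring) with he
  set φ : Fin (n + 1 + m + 1) ≃ Fin (m + 1 + n + 1) :=
    (finAddFlip : Fin (n + 1 + (m + 1)) ≃ Fin (m + 1 + (n + 1))) with hφ
  have hsign : Equiv.Perm.sign (e.symm.trans φ) = (-1) ^ ((m + 1 + n) * (m + 1)) := by
    refine sign_of_val_eq_add_mod _ fun i => ?_
    exact finAddFlip_val (m + 1) (n + 1) _
  have hA : padeMatrix n m g f pt mu lam t s
      = ((padeMatrix m n f g pt lam mu s t).submatrix id (e.symm.trans φ)).submatrix e e := by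
    have hrow0 : e 0 = 0 := rfl
    have hrow : ∀ i : Fin (n + 1 + m), e i.succ
        = Fin.succ (⟨i, by omega⟩ : Fin (m + 1 + n)) := fun i => rfl
    ext i j
    simp only [Matrix.submatrix_apply, id, Equiv.trans_apply, Equiv.symm_apply_apply]
    refine Fin.addCases (m := n + 1) (n := m + 1) (fun j => ?_) (fun j => ?_) j
    · have hφj : φ (Fin.castAdd (m + 1) j) = Fin.natAdd (m + 1) j :=
        finAddFlip_apply_castAdd j (m + 1)
      refine Fin.cases ?_ (fun i => ?_) i
      · rw [hrow0, padeMatrix_zero_castAdd, hφj, padeMatrix_zero_natAdd]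
      · rw [hrow, padeMatrix_succ_castAdd, hφj, padeMatrix_succ_natAdd]
    · have hφj : φ (Fin.natAdd (n + 1) j) = Fin.castAdd (n + 1) j :=
        finAddFlip_apply_natAdd j (n + 1)
      refine Fin.cases ?_ (fun i => ?_) i
      · rw [hrow0, padeMatrix_zero_natAdd, hφj, padeMatrix_zero_castAdd]
      · rw [hrow, padeMatrix_succ_natAdd, hφj, padeMatrix_succ_castAdd]
  rw [hA, Matrix.det_submatrix_equiv_self, Matrix.det_permute', hsign, ← mul_assoc]
  push_cast
  rw [← mul_pow]
  simp

/-- Expansion along the top row: the cofactors do not involve `s` and `t`. -/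
theorem exists_det_padeMatrix_eq (m n : ℕ) (f g : ℕ → ℂ → ℂ) (pt lam mu : ℕ → ℂ) :
    ∃ (p : Fin (m + 1) → ℂ) (q : Fin (n + 1) → ℂ), ∀ s t,
      (padeMatrix m n f g pt lam mu s t).det = ∑ j, p j * s j + ∑ j, q j * t j := by
  let minor : Fin (m + 1 + (n + 1)) → ℂ := fun j => (-1) ^ (j : ℕ)
    * ((padeMatrix m n f g pt lam mu 0 0).submatrix Fin.succ
      (Fin.succAbove (n := m + 1 + n) j)).det
  refine ⟨fun j => minor (Fin.castAdd (n + 1) j), fun j => minor (Fin.natAdd (m + 1) j),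
    fun s t => ?_⟩
  rw [Matrix.det_succ_row_zero]
  refine (Fin.sum_univ_add (a := m + 1) (b := n + 1) _).trans ?_
  congr 1
  · refine sum_congr rfl fun j _ => ?_
    rw [padeMatrix_zero_castAdd, mul_right_comm]
    rfl
  · refine sum_congr rfl fun j _ => ?_
    rw [padeMatrix_zero_natAdd, mul_right_comm]
    rfl

theorem padeMatrix_det_eq_zero (m n : ℕ) (f g : ℕ → ℂ → ℂ) (pt lam mu : ℕ → ℂ) {k : ℕ}
    (hk : k ≤ m + n) :
    (padeMatrix m n f g pt lam mu (fun j => mu k * f j (pt k))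
      (fun j => lam k * g j (pt k))).det = 0 :=
  Matrix.det_zero_of_row_eq (i := 0) (j := Fin.succ (⟨k, by omega⟩ : Fin (m + 1 + n)))
    (Fin.succ_ne_zero _).symm rfl

theorem isPadeSolution_pade (m n : ℕ) (f g : ℕ → ℂ → ℂ) (pt lam mu : ℕ → ℂ)
    (hmu : ∀ k ≤ m + n, mu k ≠ 0)
    (h : ∀ k ≤ m + n, padeP m n f g pt lam mu (pt k) ≠ 0 ∨ padeQ m n f g pt lam mu (pt k) ≠ 0) :
    IsPadeSolution m n f g pt lam mu (padeP m n f g pt lam mu) (padeQ m n f g pt lam mu) := by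
  obtain ⟨p, q, hpq⟩ := exists_det_padeMatrix_eq m n f g pt lam mu
  have hP : ∀ x, padeP m n f g pt lam mu x = ∑ j, p j * f j x := fun x => by
    rw [padeP, hpq]; simp
  have hQ : ∀ x, padeQ m n f g pt lam mu x = -∑ j, q j * g j x := fun x => by
    rw [padeQ, hpq]; simp
  refine ⟨⟨p, hP⟩, ⟨-q, fun x => by rw [hQ]; simp⟩, fun k hk => ?_⟩
  have h0 := padeMatrix_det_eq_zero m n f g pt lam mu hk
  rw [hpq] at h0
  simp only [mul_left_comm (p _), mul_left_comm (q _), ← mul_sum] at h0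
  -- A top row equal to the `k`-th interpolation row gives determinant zero, which by linearity in
  -- the top row is this relation. As `μ_k ≠ 0`, a zero of `Q` at this point would also be one of
  -- `P`.
  have hPQ : mu k * padeP m n f g pt lam mu (pt k) = lam k * padeQ m n f g pt lam mu (pt k) := by
    rw [hP, hQ]
    linear_combination h0
  have hQ0 : padeQ m n f g pt lam mu (pt k) ≠ 0 := by
    rcases h k hk with h | h
    · intro hz
      rw [hz, mul_zero] at hPQ
      exact mul_ne_zero (hmu k hk) h hPQ
    · exact h
  refine ⟨hQ0, ?_⟩
  rw [div_eq_div_iff hQ0 (hmu k hk), mul_comm, hPQ]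

theorem det_of_eq_of_eq {R : Type*} [CommRing R] (L : ℕ → ℕ → R) {k l : ℕ} (h : k = l) :
    (Matrix.of fun i j : Fin k => L i j).det = (Matrix.of fun i j : Fin l => L i j).det := by
  subst h; rfl

/-- Multiplying the interpolation rows by `L` makes the Padé matrix block triangular
as soon as the first `m` rows of `L` annihilate the values of the `g_j`. -/
theorem det_mul_det_padeMatrix (m n : ℕ) (f g : ℕ → ℂ → ℂ) (pt lam mu : ℕ → ℂ)
    (hlam : ∀ k ≤ m + n, lam k ≠ 0) (L : ℕ → ℕ → ℂ) (s : Fin (m + 1) → ℂ)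
    (hL : ∀ i < m, ∀ j ≤ n, ∑ k ∈ range (m + n + 1), L i k * g j (pt k) = 0) :
    (Matrix.of fun i j : Fin (m + n + 1) => L i j).det
        * (padeMatrix m n f g pt lam mu s fun _ => 0).det
      = (∏ i ∈ range (m + n + 1), lam i)
        * ((Matrix.of (Fin.cons s fun (i : Fin m) (j : Fin (m + 1)) =>
            ∑ k ∈ range (m + n + 1), L i k * f j (pt k) * (mu k / lam k))).det
          * (Matrix.of fun i j : Fin (n + 1) =>
            ∑ k ∈ range (m + n + 1), L (m + i : ℕ) k * g j (pt k)).det) := by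
  have hmn : m + 1 + n = m + n + 1 := by ring
  set A := padeMatrix m n f g pt lam mu s fun _ => 0 with hA
  -- The block diagonal matrix of `1` and `L · diag(λ)⁻¹`, which keeps the top row.
  let E : Matrix (Fin (m + 1 + n + 1)) (Fin (m + 1 + n + 1)) ℂ :=
    Matrix.of (Fin.cons (Fin.cons 1 fun _ => 0) fun i : Fin (m + 1 + n) =>
      Fin.cons 0 fun k : Fin (m + 1 + n) => (lam k)⁻¹ * L i k)
  have hE : (∏ i ∈ range (m + n + 1), lam i) * E.det
      = (Matrix.of fun i j : Fin (m + n + 1) => L i j).det := by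
    have h1 : E.submatrix Fin.succ (Fin.succAbove 0)
        = Matrix.of fun i k : Fin (m + 1 + n) =>
          (lam k)⁻¹ * Matrix.of (fun i k : Fin (m + 1 + n) => L i k) i k := by
      ext i k
      simp [E]
    have h2 : ∏ i ∈ range (m + n + 1), lam i ≠ 0 :=
      prod_ne_zero_iff.mpr fun i hi => hlam i (Nat.lt_succ_iff.mp (mem_range.mp hi))
    have hprod : ∏ i ∈ range (m + 1 + n), lam i = ∏ i ∈ range (m + n + 1), lam i := by rw [hmn]
    have h3 : ∀ j : Fin (m + 1 + n), E 0 j.succ = 0 := fun j => rfl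
    rw [Matrix.det_succ_row_zero, Fin.sum_univ_succ, sum_eq_zero fun j _ => by
      rw [h3, mul_zero, zero_mul], h1, Matrix.det_mul_row, det_of_eq_of_eq L hmn,
      Fin.prod_univ_eq_prod_range (fun k => (lam k)⁻¹), prod_inv_distrib, hprod]
    simp only [E, Fin.val_zero, pow_zero, Matrix.of_apply, Fin.cons_zero, one_mul, add_zero]
    rw [mul_inv_cancel_left₀ h2]
  have hrow0 : ∀ j, (E * A) 0 j = A 0 j := fun j => by
    rw [Matrix.mul_apply, Fin.sum_univ_succ]
    simp [E]
  have hrow : ∀ (i : Fin (m + 1 + n)) j, (E * A) i.succ j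
      = ∑ k : Fin (m + 1 + n), (lam k)⁻¹ * L i k * A k.succ j := fun i j => by
    rw [Matrix.mul_apply, Fin.sum_univ_succ]
    simp [E]
  have hAl : ∀ (k : Fin (m + 1 + n)) (j : Fin (m + 1)),
      A k.succ (Fin.castAdd (n + 1) j) = mu k * f j (pt k) := fun k j =>
    padeMatrix_succ_castAdd m n f g pt lam mu s _ k j
  have hAr : ∀ (k : Fin (m + 1 + n)) (j : Fin (n + 1)),
      A k.succ (Fin.natAdd (m + 1) j) = lam k * g j (pt k) := fun k j =>
    padeMatrix_succ_natAdd m n f g pt lam mu s _ k j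
  have hrowl : ∀ (i : Fin (m + 1 + n)) (j : Fin (m + 1)), (E * A) i.succ (Fin.castAdd (n + 1) j)
      = ∑ k ∈ range (m + n + 1), L i k * f j (pt k) * (mu k / lam k) := fun i j => by
    rw [hrow, ← hmn, ← Fin.sum_univ_eq_sum_range (fun k => L i k * f j (pt k) * (mu k / lam k))]
    exact sum_congr rfl fun k _ => by rw [hAl]; ring
  have hrowr : ∀ (i : Fin (m + 1 + n)) (j : Fin (n + 1)), (E * A) i.succ (Fin.natAdd (m + 1) j)
      = ∑ k ∈ range (m + n + 1), L i k * g j (pt k) := fun i j => by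
    rw [hrow, ← hmn, ← Fin.sum_univ_eq_sum_range (fun k => L i k * g j (pt k))]
    refine sum_congr rfl fun k _ => ?_
    have := hlam k (by omega)
    rw [hAr]
    field_simp
  have hblock : (E * A).submatrix (finSumFinEquiv (m := m + 1) (n := n + 1))
        (finSumFinEquiv (m := m + 1) (n := n + 1))
      = Matrix.fromBlocks
        (Matrix.of (Fin.cons s fun (i : Fin m) (j : Fin (m + 1)) =>
            ∑ k ∈ range (m + n + 1), L i k * f j (pt k) * (mu k / lam k))) 0
        (Matrix.of fun (i : Fin (n + 1)) (j : Fin (m + 1)) =>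
            ∑ k ∈ range (m + n + 1), L (m + i : ℕ) k * f j (pt k) * (mu k / lam k))
        (Matrix.of fun i j : Fin (n + 1) =>
            ∑ k ∈ range (m + n + 1), L (m + i : ℕ) k * g j (pt k)) := by
    -- The top row occupies index `0`, so row `m + 1 + i` of the product comes from row `m + i` of
    -- `L`; the upper block consists of the top row and the first `m` rows of `L`.
    have hs : ∀ i : Fin (n + 1), (Fin.natAdd (m + 1) i : Fin (m + 1 + (n + 1)))
        = Fin.succ (⟨m + i, by omega⟩ : Fin (m + 1 + n)) := fun i =>
      Fin.ext (by simp; omega)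
    have hs' : ∀ i : Fin m, (Fin.castAdd (n + 1) i.succ : Fin (m + 1 + (n + 1)))
        = Fin.succ (⟨i, by omega⟩ : Fin (m + 1 + n)) := fun i => Fin.ext (by simp)
    ext i j
    rcases i with i | i <;> rcases j with j | j
    · refine Fin.cases ?_ (fun i => ?_) i
      · exact (hrow0 _).trans (padeMatrix_zero_castAdd m n f g pt lam mu s _ j)
      · simp only [Matrix.submatrix_apply, finSumFinEquiv_apply_left, hs']
        exact hrowl _ j
    · refine Fin.cases ?_ (fun i => ?_) i
      · exact (hrow0 _).trans (padeMatrix_zero_natAdd m n f g pt lam mu s _ j)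
      · simp only [Matrix.submatrix_apply, finSumFinEquiv_apply_left, finSumFinEquiv_apply_right,
          hs']
        exact (hrowr _ j).trans (hL i i.2 j (Nat.lt_succ_iff.mp j.2))
    · simp only [Matrix.submatrix_apply, finSumFinEquiv_apply_left, finSumFinEquiv_apply_right]
      exact (congrArg (fun r => (E * A) r _) (hs i)).trans (hrowl _ j)
    · simp only [Matrix.submatrix_apply, finSumFinEquiv_apply_right]
      exact (congrArg (fun r => (E * A) r _) (hs i)).trans (hrowr _ j)
  rw [← hE, mul_assoc, ← Matrix.det_mul, ← Matrix.det_fromBlocks_zero₁₂, ← hblock]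
  congr 1
  exact (Matrix.det_submatrix_equiv_self _ _).symm

end PadeMatrix

/-! ### The determinant formulas -/

section Formulas

variable {θ : ℂ → ℂ} {δ u a b c d : ℂ}

theorem sum_entryL_mul_eq_entryΦ (hθ : IsFundamental θ) {N : ℕ} (h : IsGeneric θ δ u N a b c d)
    (ρ : ℕ → ℂ) {i j : ℕ} (hj : j ≤ N) :
    ∑ k ∈ range (N + 1), entryL θ δ u N c d i k * basisFun θ δ a b j (refPt δ u k) * ρ k
      = entryΦ θ δ u N a b c d ρ i j := by
  rw [entryΦ, mul_sum]
  refine sum_congr rfl fun k hk => ?_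
  rw [basisFun_refPt hθ h hj (Nat.lt_succ_iff.mp (mem_range.mp hk)), entryL, vterm, vterm,
    show u - c + (1 + i) * δ = u - c + δ + i * δ by ring,
    show u + d + (N - 1 - i) * δ = u + d + (N - 1) * δ - i * δ by ring]
  simp only [List.map_cons, List.map_nil, List.prod_cons, List.prod_nil]
  ring

theorem det_padeMatrix_basisFun (hθ : IsFundamental θ) {m n : ℕ}
    (h : IsGeneric θ δ u (m + n) a b c d) {lam mu : ℕ → ℂ} (hlam : ∀ k ≤ m + n, lam k ≠ 0)
    (s : Fin (m + 1) → ℂ) :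
    (padeMatrix m n (basisFun θ δ a b) (basisFun θ δ c d) (refPt δ u) lam mu s fun _ => 0).det
      = constK θ δ u m n c d * (∏ i ∈ range (m + n + 1), lam i)
        * (Matrix.of (Fin.cons s fun (i : Fin m) (j : Fin (m + 1)) =>
            entryΦ θ δ u (m + n) a b c d (fun k => mu k / lam k) i j)).det := by
  have hL0 : (matL θ δ u (m + n) c d).det ≠ 0 := by
    rw [det_matL hθ h.swap]
    exact valueDetL_ne_zero hθ h.swap
  have key := det_mul_det_padeMatrix m n (basisFun θ δ a b) (basisFun θ δ c d) (refPt δ u) lam mu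
    hlam (entryL θ δ u (m + n) c d) s fun i hi j hj => by
      rw [sum_entryL_mul_basisFun hθ h.swap (by omega) (by omega), valueLG_eq_zero hθ (by omega)]
  have hM : (Matrix.of fun i j : Fin (n + 1) => ∑ k ∈ range (m + n + 1),
      entryL θ δ u (m + n) c d (m + i : ℕ) k * basisFun θ δ c d j (refPt δ u k))
      = matM θ δ u m n c d := by
    ext i j
    rw [matM, Matrix.of_apply, Matrix.of_apply, matL_mul_matG hθ h.swap (by omega),
      sum_entryL_mul_basisFun hθ h.swap (by omega) (by omega)]
    rfl
  have hΦ : (fun (i : Fin m) (j : Fin (m + 1)) => ∑ k ∈ range (m + n + 1),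
      entryL θ δ u (m + n) c d i k * basisFun θ δ a b j (refPt δ u k) * (mu k / lam k))
      = fun (i : Fin m) (j : Fin (m + 1)) => entryΦ θ δ u (m + n) a b c d (fun k => mu k / lam k) i j := by
    funext i j
    exact sum_entryL_mul_eq_entryΦ hθ h _ (by omega)
  rw [hM, hΦ] at key
  change (matL θ δ u (m + n) c d).det * _ = _ at key
  rw [constK, div_mul_eq_mul_div, div_mul_eq_mul_div, eq_div_iff hL0]
  linear_combination key

theorem padeQ_sign (m n : ℕ) :
    -((-1 : ℂ) ^ ((m + 1 + n) * (m + 1))) = (-1) ^ (m * n + m + n) := by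
  have h : Even (m * (m + 1)) := Nat.even_mul_succ_self m
  have e : (m + 1 + n) * (m + 1) + 1 = m * n + m + n + m * (m + 1) + 2 := by ring
  rw [← neg_one_mul, ← pow_succ', e, pow_add, pow_add, h.neg_one_pow]
  norm_num

/-! ### Entries as very well-poised series -/

theorem vterm_append (a₀ : ℂ) (l l' : List ℂ) (k : ℕ) :
    vterm θ δ a₀ (l ++ l') k = vterm θ δ a₀ l k
      * (l'.map fun a => sfac θ δ a k / sfac θ δ (δ + a₀ - a) k).prod := by
  rw [vterm, vterm, List.map_append, List.prod_append, ← mul_assoc]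

/-- The parameter `-Nδ` contributes a factor `[0] = 0` to every term beyond `N`. -/
theorem vseries_eq_sum (hθ : IsFundamental θ) (N : ℕ) (a₀ : ℂ) (l : List ℂ) (z : ℂ) :
    vseries θ δ a₀ (-(N * δ) :: l) z
      = ∑ k ∈ range (N + 1), vterm θ δ a₀ (-(N * δ) :: l) k * z ^ k := by
  refine tsum_eq_sum fun k hk => ?_
  rw [vterm, List.map_cons, List.prod_cons,
    sfac_neg_eq_zero hθ (by simpa [Nat.lt_succ_iff] using hk)]
  simp

theorem entryΦ_eq_vseries (hθ : IsFundamental θ) {N r : ℕ} {ρ : ℕ → ℂ} {v : Fin r → ℂ} {z : ℂ}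
    (hρ : ∀ k ≤ N, ρ k = z ^ k * ∏ s, sfac θ δ (v s) k / sfac θ δ (δ + 2 * u - v s) k)
    (i j : ℕ) :
    entryΦ θ δ u N a b c d ρ i j = sfacPM θ δ a u j / sfacPM θ δ b u j * vseries θ δ (2 * u)
      ([-(N * δ), u - c + δ + i * δ, u + d + (N - 1) * δ - i * δ, u + c, u - d + δ,
        u + a + j * δ, u - b + δ - j * δ, u - a + δ, u + b] ++ List.ofFn v) z := by
  rw [entryΦ, List.cons_append, vseries_eq_sum hθ]
  refine congrArg (_ * ·) (sum_congr rfl fun k hk => ?_)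
  rw [hρ k (Nat.lt_succ_iff.mp (mem_range.mp hk)), ← List.cons_append, vterm_append,
    List.map_ofFn, List.prod_ofFn]
  simp only [Function.comp_apply]
  ring

/-- The two prescribed quotients in `ρ` are the inverses of the factors from `u + c`, `u - d + δ`,
`u - a + δ`, `u + b`, which shortens the series by four parameters. -/
theorem entryΦ_eq_vseries_of_cancel (hθ : IsFundamental θ) {N r : ℕ}
    (h : IsGeneric θ δ u N a b c d) {ρ : ℕ → ℂ} {v : Fin r → ℂ} {z : ℂ}
    (hρ : ∀ k ≤ N, ρ k = z ^ k
      * (sfac θ δ (u + a) k * sfac θ δ (u - b + δ) k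
          / (sfac θ δ (u - a + δ) k * sfac θ δ (u + b) k))
      * (sfac θ δ (u - c + δ) k * sfac θ δ (u + d) k
          / (sfac θ δ (u + c) k * sfac θ δ (u - d + δ) k))
      * ∏ s, sfac θ δ (v s) k / sfac θ δ (δ + 2 * u - v s) k)
    (i j : ℕ) :
    entryΦ θ δ u N a b c d ρ i j = sfacPM θ δ a u j / sfacPM θ δ b u j * vseries θ δ (2 * u)
      ([-(N * δ), u - c + δ + i * δ, u + d + (N - 1) * δ - i * δ,
        u + a + j * δ, u - b + δ - j * δ] ++ List.ofFn v) z := by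
  rw [entryΦ, List.cons_append, vseries_eq_sum hθ]
  refine congrArg (_ * ·) (sum_congr rfl fun k hk => ?_)
  have hk' : k ≤ N := Nat.lt_succ_iff.mp (mem_range.mp hk)
  rw [hρ k hk', ← List.cons_append, vterm_append, List.map_ofFn, List.prod_ofFn, vterm, vterm]
  simp only [Function.comp_apply, List.map_cons, List.map_nil, List.prod_cons, List.prod_nil]
  have ha : sfac θ δ (u + a) k ≠ 0 :=
    sfac_ne_zero fun l hl => h.add_fst_ne l (by omega) (by push_cast; ring)
  have ha' : sfac θ δ (u - a + δ) k ≠ 0 :=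
    sfac_ne_zero fun l hl => h.sub_fst_ne (l + 1) (by omega) (by push_cast; ring)
  have hb : sfac θ δ (u + b) k ≠ 0 :=
    sfac_ne_zero fun l hl => h.add_snd_ne l (by omega) (by push_cast; ring)
  have hb' : sfac θ δ (u - b + δ) k ≠ 0 :=
    sfac_ne_zero fun l hl => h.sub_snd_ne (l + 1) (by omega) (by push_cast; ring)
  have hc : sfac θ δ (u + c) k ≠ 0 :=
    sfac_ne_zero fun l hl => h.swap.add_fst_ne l (by omega) (by push_cast; ring)
  have hc' : sfac θ δ (u - c + δ) k ≠ 0 :=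
    sfac_ne_zero fun l hl => h.swap.sub_fst_ne (l + 1) (by omega) (by push_cast; ring)
  have hd : sfac θ δ (u + d) k ≠ 0 :=
    sfac_ne_zero fun l hl => h.swap.add_snd_ne l (by omega) (by push_cast; ring)
  have hd' : sfac θ δ (u - d + δ) k ≠ 0 :=
    sfac_ne_zero fun l hl => h.swap.sub_snd_ne (l + 1) (by omega) (by push_cast; ring)
  rw [show δ + 2 * u - (u + c) = u - c + δ by ring, show δ + 2 * u - (u - d + δ) = u + d by ring,
    show δ + 2 * u - (u - a + δ) = u + a by ring, show δ + 2 * u - (u + b) = u - b + δ by ring]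
  have hcancel : sfac θ δ (u + c) k / sfac θ δ (u - c + δ) k
      * (sfac θ δ (u - d + δ) k / sfac θ δ (u + d) k)
      * (sfac θ δ (u - a + δ) k / sfac θ δ (u + a) k)
      * (sfac θ δ (u + b) k / sfac θ δ (u - b + δ) k)
      * (sfac θ δ (u + a) k * sfac θ δ (u - b + δ) k
          / (sfac θ δ (u - a + δ) k * sfac θ δ (u + b) k))
      * (sfac θ δ (u - c + δ) k * sfac θ δ (u + d) k
          / (sfac θ δ (u + c) k * sfac θ δ (u - d + δ) k)) = 1 := by
    field_simp
  generalize sfac θ δ (u + c) k / sfac θ δ (u - c + δ) k = x1 at *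
  generalize sfac θ δ (u - d + δ) k / sfac θ δ (u + d) k = x2 at *
  generalize sfac θ δ (u - a + δ) k / sfac θ δ (u + a) k = x3 at *
  generalize sfac θ δ (u + b) k / sfac θ δ (u - b + δ) k = x4 at *
  generalize sfac θ δ (u + a) k * sfac θ δ (u - b + δ) k
    / (sfac θ δ (u - a + δ) k * sfac θ δ (u + b) k) = x5 at *
  generalize sfac θ δ (u - c + δ) k * sfac θ δ (u + d) k
    / (sfac θ δ (u + c) k * sfac θ δ (u - d + δ) k) = x6 at *
  have key : ∀ A B : ℂ, A = B * (x1 * x2 * x3 * x4 * x5 * x6) → A = B := fun A B hAB => by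
    rw [hAB, hcancel, mul_one]
  apply key
  ring

end Formulas

end VWPPade

end

/-! ### Assembly of the theorem -/

theorem theorem4p2 (θ : ℂ → ℂ) (hθ : IsFundamental θ) (m n : ℕ) (δ u a b c d : ℂ)
    (hgen : IsGeneric θ δ u (m + n) a b c d)
    (lam mu : ℕ → ℂ) (hlam : ∀ k ≤ m + n, lam k ≠ 0) (hmu : ∀ k ≤ m + n, mu k ≠ 0)
    (f g : ℕ → ℂ → ℂ) (hf : f = basisFun θ δ a b) (hg : g = basisFun θ δ c d)
    (P Q : ℂ → ℂ) (hP : P = padeP m n f g (refPt δ u) lam mu)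
    (hQ : Q = padeQ m n f g (refPt δ u) lam mu)
    (Φ Ψ : ℕ → ℕ → ℂ)
    (hΦ : Φ = entryΦ θ δ u (m + n) a b c d (fun k => mu k / lam k))
    (hΨ : Ψ = entryΦ θ δ u (m + n) c d a b (fun k => lam k / mu k)) :
    -- `(P, Q)` is a solution of the interpolation problem unless both vanish at some `u_k`
    ((∀ k ≤ m + n, P (refPt δ u k) ≠ 0 ∨ Q (refPt δ u k) ≠ 0) →
      IsPadeSolution m n f g (refPt δ u) lam mu P Q) ∧
    -- the two determinant formulas
    (∀ x : ℂ, P x = constK θ δ u m n c d * (∏ i ∈ Finset.range (m + n + 1), lam i)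
      * (topRowMatrix m f Φ x).det) ∧
    (∀ x : ℂ, Q x = (-1) ^ (m * n + m + n) * constK θ δ u n m a b
      * (∏ i ∈ Finset.range (m + n + 1), mu i) * (topRowMatrix n g Ψ x).det) ∧
    -- the product `LG` and its triangularity
    (∀ (i : Fin (m + n + 1)) (j : Fin (n + 1)),
      (matL θ δ u (m + n) c d * matG θ δ u (m + n) n c d) i j
        = valueLG θ δ u (m + n) c d i j) ∧
    (∀ (i : Fin (m + n + 1)) (j : Fin (n + 1)), (i : ℕ) + j < m + n →
      (matL θ δ u (m + n) c d * matG θ δ u (m + n) n c d) i j = 0) ∧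
    (∀ (i : Fin (n + m + 1)) (j : Fin (m + 1)),
      (matL θ δ u (n + m) a b * matG θ δ u (n + m) m a b) i j
        = valueLG θ δ u (n + m) a b i j) ∧
    (∀ (i : Fin (n + m + 1)) (j : Fin (m + 1)), (i : ℕ) + j < n + m →
      (matL θ δ u (n + m) a b * matG θ δ u (n + m) m a b) i j = 0) ∧
    -- the determinants whose quotients are the constants `K`
    (matM θ δ u m n c d).det = valueDetM θ δ u (m + n) n c d ∧
    (matM θ δ u n m a b).det = valueDetM θ δ u (n + m) m a b ∧
    (matL θ δ u (m + n) c d).det = valueDetL θ δ u (m + n) c d ∧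
    (matL θ δ u (m + n) c d).det ≠ 0 ∧
    (matL θ δ u (n + m) a b).det = valueDetL θ δ u (n + m) a b ∧
    (matL θ δ u (n + m) a b).det ≠ 0 ∧
    -- the entries as very well-poised series with `r + 9` parameters after the first
    (∀ (r : ℕ) (e : Fin r → ℂ) (z w : ℂ),
      (∀ k ≤ m + n, lam k / mu k
        = (z / w) ^ k * ∏ s, sfac θ δ (u - e s + δ) k / sfac θ δ (u + e s) k) →
      (∀ i j : ℕ, i < m → j ≤ m → Φ i j = sfacPM θ δ a u j / sfacPM θ δ b u j *
        vseries θ δ (2 * u)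
          ([-((m + n : ℕ) * δ), u - c + δ + i * δ, u + d + ((m + n : ℕ) - 1) * δ - i * δ,
            u + c, u - d + δ, u + a + j * δ, u - b + δ - j * δ, u - a + δ, u + b]
            ++ List.ofFn fun s => u + e s) (w / z)) ∧
      (∀ i j : ℕ, i < n → j ≤ n → Ψ i j = sfacPM θ δ c u j / sfacPM θ δ d u j *
        vseries θ δ (2 * u)
          ([-((m + n : ℕ) * δ), u - a + δ + i * δ, u + b + ((m + n : ℕ) - 1) * δ - i * δ,
            u + a, u - b + δ, u + c + j * δ, u - d + δ - j * δ, u - c + δ, u + d]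
            ++ List.ofFn fun s => u - e s + δ) (z / w))) ∧
    -- the entries as very well-poised series with `r + 5` parameters after the first
    (∀ (r : ℕ) (e : Fin r → ℂ) (z w : ℂ),
      (∀ k ≤ m + n, lam k / mu k
        = (z / w) ^ k
          * (sfac θ δ (u - a + δ) k * sfac θ δ (u + b) k
              / (sfac θ δ (u + a) k * sfac θ δ (u - b + δ) k))
          * (sfac θ δ (u + c) k * sfac θ δ (u - d + δ) k
              / (sfac θ δ (u - c + δ) k * sfac θ δ (u + d) k))
          * ∏ s, sfac θ δ (u - e s + δ) k / sfac θ δ (u + e s) k) →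
      (∀ i j : ℕ, i < m → j ≤ m → Φ i j = sfacPM θ δ a u j / sfacPM θ δ b u j *
        vseries θ δ (2 * u)
          ([-((m + n : ℕ) * δ), u - c + δ + i * δ, u + d + ((m + n : ℕ) - 1) * δ - i * δ,
            u + a + j * δ, u - b + δ - j * δ]
            ++ List.ofFn fun s => u + e s) (w / z)) ∧
      (∀ i j : ℕ, i < n → j ≤ n → Ψ i j = sfacPM θ δ c u j / sfacPM θ δ d u j *
        vseries θ δ (2 * u)
          ([-((m + n : ℕ) * δ), u - a + δ + i * δ, u + b + ((m + n : ℕ) - 1) * δ - i * δ,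
            u + c + j * δ, u - d + δ - j * δ]
            ++ List.ofFn fun s => u - e s + δ) (z / w))) := by
  subst hf hg hP hQ hΦ hΨ
  have hgen' : IsGeneric θ δ u (n + m) c d a b := Nat.add_comm m n ▸ hgen.swap
  have hinv : ∀ k, mu k / lam k = (lam k / mu k)⁻¹ := fun k => (inv_div _ _).symm
  refine ⟨isPadeSolution_pade m n _ _ _ lam mu hmu,
    fun x => det_padeMatrix_basisFun hθ hgen hlam _, fun x => ?_,
    matL_mul_matG hθ hgen.swap (Nat.le_add_left n m), fun i j hij => ?_,
    matL_mul_matG hθ hgen'.swap (Nat.le_add_left m n), fun i j hij => ?_,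
    det_matM hθ hgen.swap, det_matM hθ hgen'.swap, det_matL hθ hgen.swap, ?_,
    det_matL hθ hgen'.swap, ?_, fun r e z w hr => ⟨fun i j _ _ => ?_, fun i j _ _ => ?_⟩,
    fun r e z w hr => ⟨fun i j _ _ => ?_, fun i j _ _ => ?_⟩⟩
  -- The formula for `P` in the exchanged problem, brought back by the block swap; the minus sign in
  -- `Q_n` combines with the sign of the swap.
  · have key := det_padeMatrix_basisFun hθ hgen' (lam := mu) (mu := lam)
      (fun k hk => hmu k (by omega)) fun j => basisFun θ δ c d j x
    rw [padeQ, det_padeMatrix_swap, key, ← neg_mul, padeQ_sign, Nat.add_comm n m, mul_assoc,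
      mul_assoc, mul_assoc]
    rfl
  · rw [matL_mul_matG hθ hgen.swap (Nat.le_add_left n m), valueLG_eq_zero hθ hij]
  · rw [matL_mul_matG hθ hgen'.swap (Nat.le_add_left m n), valueLG_eq_zero hθ hij]
  · rw [det_matL hθ hgen.swap]
    exact valueDetL_ne_zero hθ hgen.swap
  · rw [det_matL hθ hgen'.swap]
    exact valueDetL_ne_zero hθ hgen'.swap
  · refine entryΦ_eq_vseries hθ (fun k hk => ?_) i j
    rw [hinv, hr k hk, mul_inv, ← inv_pow, inv_div, ← Finset.prod_inv_distrib]
    congr 1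
    refine Finset.prod_congr rfl fun s _ => ?_
    rw [inv_div]
    congr 2
    ring
  · refine entryΦ_eq_vseries hθ (fun k hk => ?_) i j
    rw [hr k hk]
    congr 1
    refine Finset.prod_congr rfl fun s _ => ?_
    congr 2
    ring
  · refine entryΦ_eq_vseries_of_cancel hθ hgen (fun k hk => ?_) i j
    rw [hinv, hr k hk, mul_inv, mul_inv, mul_inv, ← inv_pow, inv_div, inv_div, inv_div,
      ← Finset.prod_inv_distrib]
    congr 1
    refine Finset.prod_congr rfl fun s _ => ?_
    rw [inv_div]
    congr 2
    ring
  · refine entryΦ_eq_vseries_of_cancel hθ hgen.swap (fun k hk => ?_) i j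
    -- After the exchange of `(a, b)` and `(c, d)`, the `(c, d)` quotient has to come first.
    rw [hr k hk, mul_right_comm (_ ^ k)]
    congr 1
    refine Finset.prod_congr rfl fun s _ => ?_
    congr 2
    ring
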